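/- For complex numbers $x,q$ and an integer $k\ge 0$ put $(x;q)_k=\prod_{r=0}^{k-1}(1-xq^r)$, and write $$\left[\begin{matrix}a_1,\dots,a_s\\ b_1,\dots,b_t\end{matrix};q\right]_k=\frac{(a_1;q)_k\cdots(a_s;q)_k}{(b_1;q)_k\cdots(b_t;q)_k},\qquad {}_4\phi_3\!\left[\begin{matrix}a_0,a_1,a_2,a_3\\ b_1,b_2,b_3\end{matrix};q;z\right]=\sum_{k\ge 0}\left[\begin{matrix}a_0,a_1,a_2,a_3\\ q,b_1,b_2,b_3\end{matrix};q\right]_k z^k ,$$ where, if $q^{-n}$ is a numerator parameter, the series is the finite sum over $0\le k\le n$. Let $\ell,m,n$ be nonnegative integers and let $a,c,q$ be nonzero complex numbers such that no denominator in the identity below vanishes; that is, $q^k\ne 1$ for $1\le k\le\max(\ell,2m+2n)$; $a^2\neq q^k$ for $1\le k\le 2\ell+1$; $ac\ne q^k$ for $2\le k\le \ell+1$; $c\neq -q^k$ for $1\le k\le \ell$; $c^2q^{2k}\ne 1$ for $0\le k<m+n$; and $cq^{m+n+k}\neq q^{\ell}$ for $0\le k<n$. Then $$\begin{aligned} &{}_4\phi_3\!\left[\begin{matrix}a,\;q^{1+\ell}/a,\;q^{-n},\;-q^{-m-n}\\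 c,\;q^{1+\ell-m-2n}/c,\;-q\end{matrix};q;q\right] =\left[\begin{matrix}q^{2}/(ac),\,-q/a\\ q^{2}/a^2,\,-q/c\end{matrix};q\right]_{\ell} \left[\begin{matrix}q^{1+m+n},\,-q^{-\ell}c\\ q^{n+m-\ell}c,\,-q\end{matrix};q\right]_{n}\\ &\quad\times\sum_{i=0}^{\ell}\sum_{j=0}^{m}q^{(\ell+1)i-nj+\binom{j+1}{2}}\,\frac{(-1)^{i+j}}{c^i}\, \frac{1-q^{1+2i}/a^2}{1-q/a^2} \left[\begin{matrix}q^{-\ell},\,c/a,\,q/a^2\\ q,\,q^2/(ac),\,q^{2+\ell}/a^2\end{matrix};q\right]_i\\ &\quad\times\left[\begin{matrix}q^{-m},\,q^{-m-n},\,-q^{-m-n},\,q^{-i-1}ac,\,q^{i}c/a\\ q,\,c,\,-c,\,q^{-m-2n},\,q^{j-2m-2n-1}\end{matrix};q\right]_j \left[\begin{matrix}q^{j-i}ac,\,q^{1+i+j}c/a\\ q,\,q^{2j}c^2\end{matrix};q^2\right]_{m+n-j}. \end{aligned}$$ -/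

import Mathlib

/-- The `q`-shifted factorial `(x; q)_n = ∏_{k < n} (1 - x q ^ k)`. -/
noncomputable def qShifted (x q : ℂ) (n : ℕ) : ℂ :=
  ∏ k ∈ Finset.range n, (1 - x * q ^ k)

/-- The fraction form of the `q`-shifted factorial: the product of the `(x; q)_n`, for `x` in the
list `num`, divided by the product of the `(y; q)_n`, for `y` in the list `den`. -/
noncomputable def qFrac (q : ℂ) (num den : List ℂ) (n : ℕ) : ℂ :=
  (num.map fun x => qShifted x q n).prod / (den.map fun y => qShifted y q n).prod

/-- The `k`-th term of the basic hypergeometric series with numerator parameters `as` and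
denominator parameters `bs`, base `q` and argument `z`. -/
noncomputable def basicHypTerm (as bs : List ℂ) (q z : ℂ) (k : ℕ) : ℂ :=
  qFrac q as (q :: bs) k * z ^ k

/-- The basic hypergeometric series `φ` with numerator parameters `as` and denominator
parameters `bs`, base `q` and argument `z`, where `bs` has one entry less than `as`.
If `q ^ (-n)` is one of the numerator parameters, then all the terms with `k > n` are `0`
and the series is a finite sum. -/
noncomputable def basicHyp (as bs : List ℂ) (q z : ℂ) : ℂ :=
  ∑' k : ℕ, basicHypTerm as bs q z k

/-!
The left-hand side is a terminating balanced `₄φ₃`, so Sears' transformation (`sears`) applies to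
it. Three summation formulas carry the proof: the `q`-Pfaff–Saalschütz sum, the terminating
very-well-poised `₆φ₅` sum, and Andrews' terminating `q`-Watson sum. Each of them is proved by
induction on the length of the series, with an explicit telescoping certificate.

Write `N = m + n`. Sears' transformation turns the series into a prefactor times the series with
numerator parameters `q ^ (-n)`, `-q ^ (-N)`, `-q / a`, `-a q ^ (-ℓ)` and denominator parameters
`-q`, `-q ^ (1 - m - 2 n) / c`, `-c q ^ (-ℓ)`. There `ℓ` enters through one numerator and one
denominator parameter only, and the `₆φ₅` sum with base parameter `q / a ^ 2` expands the quotient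
concerned (`qShifted_shift_expansion`); this is the sum over `i`. To the `i`-th term Sears'
transformation is applied again, which produces the series with numerator parameters `q ^ (-n)`,
`-q ^ (-N)`, `c / a_i`, `c a_i / q` and denominator parameters `c`, `-c`, `q ^ (-m - 2 n)`, where
`a_i = a q ^ (-i)`. A second use of the `₆φ₅` sum, with base parameter `q ^ (-2 N - 1)`, expands
`(q ^ (-n))_k / (q ^ (-m - 2 n))_k` in such a way that after a shift of the summation index every
inner series is a `q`-Watson series (`sum_eq_sum_watsonCoeff`); this is the sum over `j`.

The intermediate series have denominators that do not occur in the identity and that may vanish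
for admissible parameters. The argument above is therefore carried out for generic parameters
(`IsGeneric`). Both sides are continuous at every admissible point (`IsAdmissible`), and every
admissible point is a limit of generic ones (`frequently_isGeneric`).
-/

open Finset

/-! ### Basic properties of `q`-shifted factorials -/

theorem qShifted_zero (x q : ℂ) : qShifted x q 0 = 1 := by simp [qShifted]

theorem qShifted_succ (x q : ℂ) (n : ℕ) :
    qShifted x q (n + 1) = qShifted x q n * (1 - x * q ^ n) := by
  simp [qShifted, prod_range_succ]

theorem qShifted_add (x q : ℂ) (m n : ℕ) :
    qShifted x q (m + n) = qShifted x q m * qShifted (x * q ^ m) q n := by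
  simp only [qShifted, prod_range_add, pow_add, mul_assoc]

theorem qShifted_succ' (x q : ℂ) (n : ℕ) :
    qShifted x q (n + 1) = (1 - x) * qShifted (x * q) q n := by
  rw [add_comm n 1, qShifted_add, qShifted_succ, qShifted_zero]; simp

theorem qShifted_ne_zero {x q : ℂ} {n : ℕ} (h : ∀ r < n, x * q ^ r ≠ 1) :
    qShifted x q n ≠ 0 :=
  prod_ne_zero_iff.2 fun r hr => sub_ne_zero.2 (h r (mem_range.1 hr)).symm

theorem qShifted_eq_zero {x q : ℂ} {n r : ℕ} (hr : r < n) (h : x * q ^ r = 1) :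
    qShifted x q n = 0 :=
  prod_eq_zero (mem_range.2 hr) (by rw [h, sub_self])

theorem qShifted_self_ne_zero {q : ℂ} (hq : ∀ k : ℕ, q ^ (k + 1) ≠ 1) (n : ℕ) :
    qShifted q q n ≠ 0 :=
  qShifted_ne_zero fun r _ => by rw [← pow_succ']; exact hq r

theorem qShifted_inv_pow_eq_zero {q : ℂ} (hq0 : q ≠ 0) {n k : ℕ} (h : n < k) :
    qShifted (q ^ n)⁻¹ q k = 0 :=
  qShifted_eq_zero h (inv_mul_cancel₀ (pow_ne_zero _ hq0))

/-! ### The `q`-Saalschütz sum -/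

/-- Partial sums of the recurrence in `k` satisfied by the summand of `saalschutz_coeff`; at `J = k`
the right-hand side cancels the term `j = k + 1` of the sum for `k + 1`. -/
theorem saalschutz_telescope {X Y d q : ℂ} (hX : X ≠ 0) (hY : Y ≠ 0)
    (hq : ∀ k : ℕ, q ^ (k + 1) ≠ 1) (hd : ∀ k : ℕ, d * q ^ k ≠ 1) (J : ℕ) :
    ∀ k, J ≤ k →
    ∑ j ∈ range (J + 1), ((1 - q ^ (k + 1)) * (1 - d * q ^ k) *
        (qShifted X q j * qShifted Y q j * (d / (X * Y)) ^ j / (qShifted q q j * qShifted d q j) *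
          (qShifted (d / (X * Y)) q (k + 1 - j) / qShifted q q (k + 1 - j))) -
      (1 - d / X * q ^ k) * (1 - d / Y * q ^ k) *
        (qShifted X q j * qShifted Y q j * (d / (X * Y)) ^ j / (qShifted q q j * qShifted d q j) *
          (qShifted (d / (X * Y)) q (k - j) / qShifted q q (k - j)))) =
      -q ^ (k - J) * (qShifted X q (J + 1) * qShifted Y q (J + 1) * (d / (X * Y)) ^ (J + 1) /
        (qShifted q q J * qShifted d q J) *
        (qShifted (d / (X * Y)) q (k - J) / qShifted q q (k - J))) := by
  have hqs := qShifted_self_ne_zero hq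
  have hds : ∀ n, qShifted d q n ≠ 0 := fun n => qShifted_ne_zero fun r _ => hd r
  have h1 : ∀ n, 1 - q * q ^ n ≠ 0 := fun n => by
    rw [← pow_succ']; exact sub_ne_zero.2 (hq n).symm
  have h2 : ∀ n, 1 - d * q ^ n ≠ 0 := fun n => sub_ne_zero.2 (hd n).symm
  induction J with
  | zero =>
    intro k _
    simp only [zero_add, sum_range_one, Nat.sub_zero, qShifted_zero, qShifted_succ, pow_zero,
      pow_succ']
    have := hqs k
    have := h1 k
    have := h2 k
    field_simp
    ring
  | succ J ih =>
    intro k hk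
    obtain ⟨r, rfl⟩ := Nat.exists_eq_add_of_le hk
    rw [sum_range_succ, ih _ (by omega)]
    have e1 : J + 1 + r + 1 - (J + 1) = r + 1 := by omega
    have e2 : J + 1 + r - (J + 1) = r := by omega
    have e3 : J + 1 + r - J = r + 1 := by omega
    rw [e1, e2, e3]
    simp only [qShifted_succ _ _ r, qShifted_succ _ _ (J + 1)]
    rw [qShifted_succ q q J, qShifted_succ d q J]
    have := hqs r
    have := hqs J
    have := hds J
    have := h1 r
    have := h1 J
    have := h2 J
    simp only [pow_succ', pow_add]
    field_simp
    ring

/-- The coefficient form of the `q`-Pfaff–Saalschütz sum: comparison of the coefficients of `z ^ k`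
in the `q`-Euler transformation. Only the denominators `(q; q)_j` and `(d; q)_j` occur in it. -/
theorem saalschutz_coeff {X Y d q : ℂ} (hX : X ≠ 0) (hY : Y ≠ 0)
    (hq : ∀ k : ℕ, q ^ (k + 1) ≠ 1) (hd : ∀ k : ℕ, d * q ^ k ≠ 1) (k : ℕ) :
    ∑ j ∈ range (k + 1),
        qShifted X q j * qShifted Y q j * (d / (X * Y)) ^ j / (qShifted q q j * qShifted d q j) *
          (qShifted (d / (X * Y)) q (k - j) / qShifted q q (k - j)) =
      qShifted (d / X) q k * qShifted (d / Y) q k / (qShifted q q k * qShifted d q k) := by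
  have hqs := qShifted_self_ne_zero hq
  have hds : ∀ n, qShifted d q n ≠ 0 := fun n => qShifted_ne_zero fun r _ => hd r
  have h1 : ∀ n, 1 - q * q ^ n ≠ 0 := fun n => by
    rw [← pow_succ']; exact sub_ne_zero.2 (hq n).symm
  have h2 : ∀ n, 1 - d * q ^ n ≠ 0 := fun n => sub_ne_zero.2 (hd n).symm
  induction k with
  | zero => simp [qShifted_zero]
  | succ k ih =>
    have ht := saalschutz_telescope hX hY hq hd k k le_rfl
    rw [sum_sub_distrib, ← mul_sum, ← mul_sum, ih] at ht
    rw [sum_range_succ]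
    simp only [Nat.sub_self, qShifted_zero, pow_zero] at ht ⊢
    have hp : (1 - q ^ (k + 1)) * (1 - d * q ^ k) ≠ 0 :=
      mul_ne_zero (by rw [pow_succ']; exact h1 k) (h2 k)
    apply mul_left_cancel₀ hp
    rw [mul_add]
    rw [sub_eq_iff_eq_add] at ht
    rw [ht]
    simp only [qShifted_succ q, qShifted_succ d, qShifted_succ (d / X), qShifted_succ (d / Y)]
    have := hqs k
    have := hds k
    have := h1 k
    have := h2 k
    rw [pow_succ' q]
    generalize qShifted (d / X) q k = U
    generalize qShifted (d / Y) q k = V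
    generalize (d / (X * Y)) ^ (k + 1) = W
    generalize 1 - d / X * q ^ k = y3
    generalize 1 - d / Y * q ^ k = y4
    generalize 1 - q * q ^ k = y1 at *
    generalize 1 - d * q ^ k = y2 at *
    field_simp
    ring

/-! ### The terminating `₆φ₅` sum -/

/-- The term of the very-well-poised series `₆φ₅` with parameters `A; b, c, q ^ (-l)`. -/
noncomputable def vwpTerm (A b c q : ℂ) (l i : ℕ) : ℂ :=
  (1 - A * q ^ (2 * i)) / (1 - A) *
    (qShifted A q i * qShifted b q i * qShifted c q i * qShifted (q ^ l)⁻¹ q i /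
      (qShifted q q i * qShifted (A * q / b) q i * qShifted (A * q / c) q i *
        qShifted (A * q ^ (l + 1)) q i)) * (A * q ^ (l + 1) / (b * c)) ^ i

/-- Partial sums of the recurrence in `l` satisfied by `vwpTerm`. The right-hand side vanishes at
`I = l + 1`, because it contains `(q ^ (-l); q)_I`. -/
theorem vwp_telescope {A b c q : ℂ} {l : ℕ} (hq0 : q ≠ 0) (hb : b ≠ 0) (hc : c ≠ 0)
    (hq : ∀ k : ℕ, q ^ (k + 1) ≠ 1) (hA : ∀ r ≤ 2 * (l + 1), A * q ^ r ≠ 1)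
    (hAb : ∀ r < l + 1, A * q / b * q ^ r ≠ 1) (hAc : ∀ r < l + 1, A * q / c * q ^ r ≠ 1)
    (I : ℕ) (hI : I ≤ l + 1) :
    ∑ i ∈ range (I + 1), ((1 - A * q ^ (l + 1) / b) * (1 - A * q ^ (l + 1) / c) *
        vwpTerm A b c q (l + 1) i -
      (1 - A * q ^ (l + 1)) * (1 - A * q ^ (l + 1) / (b * c)) * vwpTerm A b c q l i) =
      (A * q ^ (l + 1) / (b * c)) ^ (I + 1) *
        (qShifted (A * q) q I * qShifted b q (I + 1) * qShifted c q (I + 1) *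
          qShifted (q ^ l)⁻¹ q I /
        (qShifted q q I * qShifted (A * q / b) q I * qShifted (A * q / c) q I *
          qShifted (A * q ^ (l + 2)) q I)) := by
  have hA1 : 1 - A ≠ 0 := sub_ne_zero.2 (by simpa using (hA 0 (by omega)).symm)
  induction I with
  | zero =>
    simp only [zero_add, sum_range_one, vwpTerm, qShifted_zero, qShifted_succ, pow_zero, mul_zero]
    field_simp
    ring
  | succ I ih =>
    rw [sum_range_succ, ih (by omega)]
    have d1 : qShifted q q I ≠ 0 := qShifted_self_ne_zero hq I
    have d2 : 1 - q * q ^ I ≠ 0 := by rw [← pow_succ']; exact sub_ne_zero.2 (hq I).symm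
    have d3 : qShifted (A * q / b) q I ≠ 0 := qShifted_ne_zero fun r hr => hAb r (by omega)
    have d4 : qShifted (A * q / c) q I ≠ 0 := qShifted_ne_zero fun r hr => hAc r (by omega)
    have d5 : 1 - A * q / b * q ^ I ≠ 0 := sub_ne_zero.2 (hAb I (by omega)).symm
    have d6 : 1 - A * q / c * q ^ I ≠ 0 := sub_ne_zero.2 (hAc I (by omega)).symm
    have d7 : qShifted (A * q ^ (l + 2)) q I ≠ 0 := qShifted_ne_zero fun r hr => by
      rw [mul_assoc, ← pow_add]; exact hA _ (by omega)
    have d8 : 1 - A * q ^ (l + 2) * q ^ I ≠ 0 := by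
      rw [mul_assoc, ← pow_add]; exact sub_ne_zero.2 (hA _ (by omega)).symm
    have d9 : 1 - A * q ^ (l + 1) ≠ 0 := sub_ne_zero.2 (hA _ (by omega)).symm
    have e1 : qShifted (A * q ^ (l + 1)) q (I + 1) =
        (1 - A * q ^ (l + 1)) * qShifted (A * q ^ (l + 2)) q I := by
      rw [qShifted_succ', mul_assoc, ← pow_succ]
    have e2 : qShifted (q ^ (l + 1))⁻¹ q (I + 1) =
        (1 - (q ^ (l + 1))⁻¹) * qShifted (q ^ l)⁻¹ q I := by
      rw [qShifted_succ', pow_succ, mul_inv, mul_assoc, inv_mul_cancel₀ hq0, mul_one]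
    have e3 : qShifted A q (I + 1) = (1 - A) * qShifted (A * q) q I := qShifted_succ' ..
    simp only [vwpTerm, e1, e2, e3, qShifted_succ _ _ (I + 1)]
    simp only [qShifted_succ q q I, qShifted_succ (A * q / b) q I, qShifted_succ (A * q / c) q I,
      qShifted_succ (A * q ^ (l + 2)) q I, qShifted_succ (A * q) q I,
      qShifted_succ (q ^ l)⁻¹ q I]
    have : A * q ^ (l + 1 + 1) = A * q ^ (l + 2) := rfl
    rw [this]
    generalize qShifted q q I = x1 at *
    generalize qShifted (A * q / b) q I = x2 at *
    generalize qShifted (A * q / c) q I = x3 at *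
    generalize qShifted (A * q ^ (l + 2)) q I = x4 at *
    generalize qShifted (q ^ l)⁻¹ q I = x5 at *
    generalize qShifted (A * q) q I = x6 at *
    generalize qShifted b q (I + 1) = x7 at *
    generalize qShifted c q (I + 1) = x8 at *
    have hz : (A * q ^ (l + 2) / (b * c)) ^ (I + 1) =
        (A * q ^ (l + 1) / (b * c)) ^ (I + 1) * (q * q ^ I) := by
      rw [← pow_succ', ← mul_pow]; congr 1; ring
    have hz2 : (A * q ^ (l + 1) / (b * c)) ^ (I + 1 + 1) =
        (A * q ^ (l + 1) / (b * c)) ^ (I + 1) * (A * q ^ (l + 1) / (b * c)) := pow_succ ..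
    rw [hz, hz2]
    generalize (A * q ^ (l + 1) / (b * c)) ^ (I + 1) = z at *
    have p1 : q ^ (2 * (I + 1)) = q ^ 2 * (q ^ I) ^ 2 := by ring
    have p2 : q ^ (l + 2) = q ^ 2 * q ^ l := by ring
    have p3 : q ^ (l + 1) = q * q ^ l := by ring
    have p4 : q ^ (I + 1) = q * q ^ I := by ring
    rw [p1, p3, p4]
    rw [p2] at d8 ⊢
    rw [p3] at d9
    have hQ : q ^ I ≠ 0 := pow_ne_zero _ hq0
    have hP : q ^ l ≠ 0 := pow_ne_zero _ hq0
    generalize q ^ I = Q at *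
    generalize q ^ l = P at *
    generalize hy1 : 1 - A * (q * P) = y1 at *
    generalize hy2 : 1 - A * (q ^ 2 * P) * Q = y2 at *
    generalize hy3 : 1 - A * q / b * Q = y3 at *
    generalize hy4 : 1 - A * q / c * Q = y4 at *
    generalize hy5 : 1 - q * Q = y5 at *
    field_simp
    rw [← hy2, ← hy3, ← hy4, ← hy5]
    field_simp
    ring

/-- The terminating very-well-poised `₆φ₅` sum. -/
theorem sum_vwpTerm {A b c q : ℂ} (hq0 : q ≠ 0) (hb : b ≠ 0) (hc : c ≠ 0)
    (hq : ∀ k : ℕ, q ^ (k + 1) ≠ 1) (l : ℕ) (hA : ∀ r ≤ 2 * l, A * q ^ r ≠ 1)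
    (hAb : ∀ r < l, A * q / b * q ^ r ≠ 1) (hAc : ∀ r < l, A * q / c * q ^ r ≠ 1) :
    ∑ i ∈ range (l + 1), vwpTerm A b c q l i =
      qShifted (A * q) q l * qShifted (A * q / (b * c)) q l /
        (qShifted (A * q / b) q l * qShifted (A * q / c) q l) := by
  induction l with
  | zero =>
    have hA1 : 1 - A ≠ 0 := sub_ne_zero.2 (by simpa using (hA 0 (by omega)).symm)
    simp [vwpTerm, qShifted_zero, hA1]
  | succ l ih =>
    have ih := ih (fun r hr => hA r (by omega)) (fun r hr => hAb r (by omega))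
      (fun r hr => hAc r (by omega))
    have ht := vwp_telescope hq0 hb hc hq hA hAb hAc (l + 1) le_rfl
    have h0 := qShifted_inv_pow_eq_zero hq0 (Nat.lt_succ_self l)
    have h0' : vwpTerm A b c q l (l + 1) = 0 := by simp [vwpTerm, h0]
    rw [sum_sub_distrib, ← mul_sum, ← mul_sum, sum_range_succ _ (l + 1),
      sum_range_succ _ (l + 1), h0', add_zero, ih, h0] at ht
    rw [sum_range_succ]
    have d5 : 1 - A * q ^ (l + 1) / b ≠ 0 := by
      have := hAb l (by omega)
      rw [pow_succ']; contrapose! this; linear_combination -this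
    have d6 : 1 - A * q ^ (l + 1) / c ≠ 0 := by
      have := hAc l (by omega)
      rw [pow_succ']; contrapose! this; linear_combination -this
    apply mul_left_cancel₀ (mul_ne_zero d5 d6)
    rw [mul_zero, zero_div, mul_zero, sub_eq_zero] at ht
    rw [ht]
    simp only [qShifted_succ]
    have e1 : A * q / b * q ^ l = A * q ^ (l + 1) / b := by ring
    have e2 : A * q / c * q ^ l = A * q ^ (l + 1) / c := by ring
    have e3 : A * q / (b * c) * q ^ l = A * q ^ (l + 1) / (b * c) := by ring
    have e4 : A * q * q ^ l = A * q ^ (l + 1) := by ring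
    rw [e1, e2, e3, e4]
    have : qShifted (A * q / b) q l ≠ 0 := qShifted_ne_zero fun r hr => hAb r (by omega)
    have : qShifted (A * q / c) q l ≠ 0 := qShifted_ne_zero fun r hr => hAc r (by omega)
    generalize 1 - A * q ^ (l + 1) / b = y1 at *
    generalize 1 - A * q ^ (l + 1) / c = y2 at *
    field_simp

/-! ### Andrews' terminating `q`-analogue of Watson's sum -/

/-- The term of the terminating `q`-Watson series with numerator parameters `u`, `v`, `q ^ (-N)`,
`-q ^ (-N)`. The denominator parameters `c`, `-c` with `c ^ 2 = q u v` are combined into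
`(q u v; q ^ 2)_k`, so that no square root has to be chosen. -/
noncomputable def watsonTerm (u v q : ℂ) (N k : ℕ) : ℂ :=
  qShifted u q k * qShifted v q k * (qShifted (q ^ N)⁻¹ q k * qShifted (-(q ^ N)⁻¹) q k) /
    (qShifted q q k * qShifted (q * u * v) (q ^ 2) k * qShifted (q ^ (2 * N))⁻¹ q k) * q ^ k

theorem inv_pow_mul_pow_ne_one {q : ℂ} (hq0 : q ≠ 0) (hq : ∀ k : ℕ, q ^ (k + 1) ≠ 1) {M r : ℕ}
    (h : r < M) : (q ^ M)⁻¹ * q ^ r ≠ 1 := by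
  obtain ⟨s, rfl⟩ := Nat.exists_eq_add_of_lt h
  intro h
  apply hq s
  have h1 : q ^ r ≠ 0 := pow_ne_zero _ hq0
  rw [inv_mul_eq_one₀ (pow_ne_zero _ hq0)] at h
  have : q ^ r * q ^ (s + 1) = q ^ r * 1 := by rw [← pow_add, mul_one, ← add_assoc]; exact h
  exact mul_left_cancel₀ h1 this

/-- Partial sums of the recurrence in `N` satisfied by `watsonTerm`. The right-hand side vanishes at
`I = N + 1`, because it contains `(q ^ (-N); q)_I`. The case `N = 0` is excluded since then
`(q ^ (-2 N); q)_1 = 0`. -/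
theorem watson_telescope {u v q : ℂ} {N : ℕ} (hq0 : q ≠ 0)
    (hq : ∀ k : ℕ, q ^ (k + 1) ≠ 1) (huv : ∀ k : ℕ, q * u * v * (q ^ 2) ^ k ≠ 1)
    (hN : 1 ≤ N) (I : ℕ) (hI : I ≤ N + 1) :
    ∑ k ∈ range (I + 1), ((1 - q ^ (2 * N + 1)) * (1 - u * v * q ^ (2 * N + 1)) *
        watsonTerm u v q (N + 1) k -
      (1 - u * q ^ (2 * N + 1)) * (1 - v * q ^ (2 * N + 1)) * watsonTerm u v q N k) =
      -q ^ (2 * N + 1) * (qShifted u q (I + 1) * qShifted v q (I + 1) *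
        (qShifted (q ^ N)⁻¹ q I * qShifted (-(q ^ N)⁻¹) q I) /
    (qShifted q q I * qShifted (q * u * v) (q ^ 2) I * qShifted (q ^ (2 * N))⁻¹ q I)) := by
  induction I with
  | zero =>
    simp only [zero_add, sum_range_one, watsonTerm, qShifted_zero, qShifted_succ, pow_zero]
    ring
  | succ I ih =>
    rw [sum_range_succ, ih (by omega)]
    have d1 : qShifted q q I ≠ 0 := qShifted_self_ne_zero hq I
    have d2 : 1 - q * q ^ I ≠ 0 := by rw [← pow_succ']; exact sub_ne_zero.2 (hq I).symm
    have d3 : qShifted (q * u * v) (q ^ 2) I ≠ 0 := qShifted_ne_zero fun r _ => huv r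
    have d4 : 1 - q * u * v * (q ^ 2) ^ I ≠ 0 := sub_ne_zero.2 (huv I).symm
    have hM : ∀ M r, r < M → 1 - (q ^ M)⁻¹ * q ^ r ≠ 0 := fun M r h =>
      sub_ne_zero.2 (inv_pow_mul_pow_ne_one hq0 hq h).symm
    have d5 : qShifted (q ^ (2 * N))⁻¹ q I ≠ 0 := qShifted_ne_zero fun r hr =>
      inv_pow_mul_pow_ne_one hq0 hq (by omega)
    have d6 := hM (2 * N) I (by omega)
    have d7 : 1 - (q ^ (2 * N + 1))⁻¹ ≠ 0 := by simpa using hM (2 * N + 1) 0 (by omega)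
    have d8 : 1 - (q ^ (2 * N + 2))⁻¹ ≠ 0 := by simpa using hM (2 * N + 2) 0 (by omega)
    have d9 := hM (2 * N + 1) I (by omega)
    have e2 : qShifted (q ^ (N + 1))⁻¹ q (I + 1) =
        (1 - (q ^ (N + 1))⁻¹) * qShifted (q ^ N)⁻¹ q I := by
      rw [qShifted_succ', pow_succ, mul_inv, mul_assoc, inv_mul_cancel₀ hq0, mul_one]
    have e3 : qShifted (-(q ^ (N + 1))⁻¹) q (I + 1) =
        (1 + (q ^ (N + 1))⁻¹) * qShifted (-(q ^ N)⁻¹) q I := by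
      rw [qShifted_succ', pow_succ, mul_inv, neg_mul, mul_assoc, inv_mul_cancel₀ hq0, mul_one,
        sub_neg_eq_add]
    have e4 : qShifted (q ^ (2 * (N + 1)))⁻¹ q (I + 1) =
        (1 - (q ^ (2 * N + 2))⁻¹) * ((1 - (q ^ (2 * N + 1))⁻¹) * qShifted (q ^ (2 * N))⁻¹ q I) /
          (1 - (q ^ (2 * N + 1))⁻¹ * q ^ I) := by
      rw [eq_div_iff d9]
      have h1 : (q ^ (2 * N + 2))⁻¹ * q = (q ^ (2 * N + 1))⁻¹ := by
        rw [pow_succ _ (2 * N + 1), mul_inv, mul_assoc, inv_mul_cancel₀ hq0, mul_one]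
      have h2 : (q ^ (2 * N + 1))⁻¹ * q = (q ^ (2 * N))⁻¹ := by
        rw [pow_succ _ (2 * N), mul_inv, mul_assoc, inv_mul_cancel₀ hq0, mul_one]
      rw [← h2, ← qShifted_succ', ← h1, mul_assoc _ q, ← pow_succ', mul_add, mul_one,
        ← qShifted_succ, ← qShifted_succ']
    simp only [watsonTerm, e2, e3, e4, qShifted_succ _ _ (I + 1)]
    simp only [qShifted_succ q q I, qShifted_succ (q * u * v) (q ^ 2) I,
      qShifted_succ (q ^ N)⁻¹ q I, qShifted_succ (-(q ^ N)⁻¹) q I,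
      qShifted_succ (q ^ (2 * N))⁻¹ q I]
    generalize qShifted q q I = x1 at *
    generalize qShifted (q * u * v) (q ^ 2) I = x2 at *
    generalize qShifted (q ^ (2 * N))⁻¹ q I = x3 at *
    generalize qShifted (q ^ N)⁻¹ q I = x5 at *
    generalize qShifted (-(q ^ N)⁻¹) q I = x6 at *
    generalize qShifted u q (I + 1) = x7 at *
    generalize qShifted v q (I + 1) = x8 at *
    have p1 : (q ^ 2) ^ I = (q ^ I) ^ 2 := by ring
    have p2 : q ^ (2 * N) = (q ^ N) ^ 2 := by ring
    have p3 : q ^ (2 * N + 1) = q * (q ^ N) ^ 2 := by ring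
    have p3' : q ^ (2 * N + 2) = q ^ 2 * (q ^ N) ^ 2 := by ring
    have p4 : q ^ (I + 1) = q * q ^ I := by ring
    have p5 : q ^ (N + 1) = q * q ^ N := by ring
    simp only [p1, p2, p3, p4, p5, p3'] at *
    have hQ : q ^ I ≠ 0 := pow_ne_zero _ hq0
    have hP : q ^ N ≠ 0 := pow_ne_zero _ hq0
    generalize q ^ I = Q at *
    generalize q ^ N = P at *
    have d6' : P ^ 2 - Q ≠ 0 := by
      intro h; apply d6; field_simp; linear_combination h
    have d7' : q * P ^ 2 - 1 ≠ 0 := by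
      intro h; apply d7; field_simp; linear_combination h
    have d8' : q ^ 2 * P ^ 2 - 1 ≠ 0 := by
      intro h; apply d8; field_simp; linear_combination h
    have d9' : q * P ^ 2 - Q ≠ 0 := by
      intro h; apply d9; field_simp; linear_combination h
    have d4' : 1 - q * u * v * Q ^ 2 ≠ 0 := d4
    field_simp
    ring

/-- Andrews' terminating `q`-analogue of Watson's sum. -/
theorem sum_watsonTerm {u v q : ℂ} (hq0 : q ≠ 0)
    (hq : ∀ k : ℕ, q ^ (k + 1) ≠ 1) (huv : ∀ k : ℕ, q * u * v * (q ^ 2) ^ k ≠ 1) (N : ℕ) :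
    ∑ k ∈ range (N + 1), watsonTerm u v q N k =
      qShifted (q * u) (q ^ 2) N * qShifted (q * v) (q ^ 2) N /
        (qShifted q (q ^ 2) N * qShifted (q * u * v) (q ^ 2) N) := by
  rcases Nat.eq_zero_or_pos N with rfl | hN
  · simp [watsonTerm, qShifted_zero]
  induction N, hN using Nat.le_induction with
  | base =>
    have d1 : 1 - q ≠ 0 := sub_ne_zero.2 (by simpa using (hq 0).symm)
    have d2 : 1 - q * u * v ≠ 0 := sub_ne_zero.2 (by simpa using (huv 0).symm)
    have d3 : q ^ 2 - 1 ≠ 0 := sub_ne_zero.2 (by simpa using (hq 1))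
    simp [watsonTerm, qShifted_zero, sum_range_succ, qShifted_succ]
    generalize hy : 1 - q * u * v = y at *
    field_simp
    rw [← hy]
    ring
  | succ N hN ih =>
    -- The term `k = N + 1` vanishes in the sum for `N`, so both sums can be cut at `N + 1`.
    have ht := watson_telescope hq0 hq huv hN (N + 1) le_rfl
    have h0 := qShifted_inv_pow_eq_zero hq0 (Nat.lt_succ_self N)
    have h0' : watsonTerm u v q N (N + 1) = 0 := by simp [watsonTerm, h0]
    rw [sum_sub_distrib, ← mul_sum, ← mul_sum, sum_range_succ _ (N + 1),
      sum_range_succ _ (N + 1), h0', add_zero, ih, h0] at ht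
    rw [sum_range_succ]
    have e1 : q * (q ^ 2) ^ N = q ^ (2 * N + 1) := by ring
    have d5 : 1 - q ^ (2 * N + 1) ≠ 0 := sub_ne_zero.2 (hq _).symm
    have d6 : 1 - u * v * q ^ (2 * N + 1) ≠ 0 := by
      have := huv N
      contrapose! this; linear_combination (-this + u * v * e1)
    apply mul_left_cancel₀ (mul_ne_zero d5 d6)
    rw [zero_mul, mul_zero, zero_div, mul_zero, sub_eq_zero] at ht
    rw [ht]
    simp only [qShifted_succ]
    have e2 : q * u * (q ^ 2) ^ N = u * q ^ (2 * N + 1) := by ring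
    have e3 : q * v * (q ^ 2) ^ N = v * q ^ (2 * N + 1) := by ring
    have e4 : q * u * v * (q ^ 2) ^ N = u * v * q ^ (2 * N + 1) := by ring
    rw [e1, e2, e3, e4]
    have : qShifted q (q ^ 2) N ≠ 0 := qShifted_ne_zero fun r hr => by
      rw [← pow_mul, ← pow_succ']; exact hq _
    have : qShifted (q * u * v) (q ^ 2) N ≠ 0 := qShifted_ne_zero fun r hr => huv r
    generalize 1 - q ^ (2 * N + 1) = y1 at *
    generalize 1 - u * v * q ^ (2 * N + 1) = y2 at *
    field_simp

/-! ### Reversal of `q`-shifted factorials and Sears' transformation -/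

/-- The monomial `∏_{s < r} (-q ^ (M - 1 - s))` by which `(x q ^ (M - r); q)_r` and
`x ^ r (q ^ (1 - M) / x; q)_r` differ. -/
noncomputable def revFactor (q : ℂ) (M r : ℕ) : ℂ :=
  ∏ s ∈ range r, -(q ^ M / q ^ (s + 1))

theorem revFactor_ne_zero {q : ℂ} (hq0 : q ≠ 0) (M r : ℕ) : revFactor q M r ≠ 0 :=
  prod_ne_zero_iff.2 fun _ _ =>
    neg_ne_zero.2 (div_ne_zero (pow_ne_zero _ hq0) (pow_ne_zero _ hq0))

theorem revFactor_sq {q : ℂ} (hq0 : q ≠ 0) (M r : ℕ) :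
    revFactor q M r ^ 2 * q ^ (r * (r + 1)) = q ^ (2 * M * r) := by
  induction r with
  | zero => simp [revFactor]
  | succ r ih =>
    rw [revFactor, prod_range_succ, ← revFactor]
    have h : (r + 1) * (r + 1 + 1) = r * (r + 1) + 2 * (r + 1) := by ring
    have h' : 2 * M * (r + 1) = 2 * M * r + 2 * M := by ring
    rw [h, h', pow_add q (r * (r + 1)), pow_add q (2 * M * r), ← ih]
    have := pow_ne_zero (r + 1) hq0
    field_simp
    ring

/-- The last `r` factors of `(x; q)_M`, in reverse order, form a `q`-shifted factorial with
parameter `q ^ (1 - M) / x`. -/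
theorem qShifted_reverse {x q : ℂ} (hx : x ≠ 0) (hq0 : q ≠ 0) {M r : ℕ} (hr : r ≤ M) :
    qShifted x q M =
      qShifted x q (M - r) * (qShifted (q / (q ^ M * x)) q r * (x ^ r * revFactor q M r)) := by
  induction r with
  | zero => simp [qShifted_zero, revFactor]
  | succ r ih =>
    obtain ⟨s, rfl⟩ := Nat.exists_eq_add_of_le hr
    rw [ih (by omega)]
    have e1 : r + 1 + s - r = s + 1 := by omega
    have e2 : r + 1 + s - (r + 1) = s := by omega
    rw [e1, e2, qShifted_succ, qShifted_succ, revFactor, revFactor, prod_range_succ, pow_add q,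
      pow_succ x]
    have := pow_ne_zero (r + 1) hq0
    have := pow_ne_zero s hq0
    have h3 : 1 - x * q ^ s =
        (1 - q / (q ^ (r + 1) * q ^ s * x) * q ^ r) *
          (x * -(q ^ (r + 1) * q ^ s / q ^ (r + 1))) := by
      have := pow_ne_zero r hq0
      rw [pow_succ' q r]
      field_simp
      ring
    rw [h3]
    ring

theorem qShifted_reverse_full {x q : ℂ} (hx : x ≠ 0) (hq0 : q ≠ 0) (M : ℕ) :
    qShifted x q M = qShifted (q / (q ^ M * x)) q M * (x ^ M * revFactor q M M) := by
  simpa [qShifted_zero] using qShifted_reverse hx hq0 (le_refl M)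

theorem qShifted_sub {x q : ℂ} (hx : x ≠ 0) (hq0 : q ≠ 0) {M r : ℕ} (hr : r ≤ M)
    (h : ∀ s < r, q / (q ^ M * x) * q ^ s ≠ 1) :
    qShifted x q (M - r) =
      qShifted x q M / (qShifted (q / (q ^ M * x)) q r * (x ^ r * revFactor q M r)) := by
  rw [eq_div_iff, ← qShifted_reverse hx hq0 hr]
  exact mul_ne_zero (qShifted_ne_zero h)
    (mul_ne_zero (pow_ne_zero _ hx) (revFactor_ne_zero hq0 _ _))

/-- The `q`-Pfaff–Saalschütz sum of a terminating balanced `₃φ₂`. -/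
theorem saalschutz {α ε C D q : ℂ} (M : ℕ) (hq0 : q ≠ 0) (hα : α ≠ 0) (hC : C ≠ 0) (hD : D ≠ 0)
    (hq : ∀ k : ℕ, q ^ (k + 1) ≠ 1) (hCq : ∀ k : ℕ, C * q ^ k ≠ 1) (hDq : ∀ k : ℕ, D * q ^ k ≠ 1)
    (hαq : ∀ k : ℕ, q ^ (k + 1) ≠ q ^ M * α) (hbal : C * D * q ^ M = α * ε * q) :
    ∑ r ∈ range (M + 1), qShifted (q ^ M)⁻¹ q r * qShifted α q r * qShifted ε q r /
        (qShifted q q r * qShifted C q r * qShifted D q r) * q ^ r =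
      α ^ M * (qShifted (C / α) q M * qShifted (D / α) q M) /
        (qShifted C q M * qShifted D q M) := by
  have hM : q ^ M ≠ 0 := pow_ne_zero _ hq0
  have hε : ε ≠ 0 := by
    rintro rfl
    rw [mul_zero, zero_mul] at hbal
    exact mul_ne_zero (mul_ne_zero hC hD) hM hbal
  obtain ⟨d, hd⟩ : ∃ d, d = q / (q ^ M * α) := ⟨_, rfl⟩
  obtain ⟨X, hX⟩ : ∃ X, X = q / (q ^ M * C) := ⟨_, rfl⟩
  obtain ⟨Y, hY⟩ : ∃ Y, Y = q / (q ^ M * D) := ⟨_, rfl⟩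
  have hd0 : d ≠ 0 := by rw [hd]; positivity
  have hX0 : X ≠ 0 := by rw [hX]; positivity
  have hY0 : Y ≠ 0 := by rw [hY]; positivity
  have hdq : ∀ k : ℕ, d * q ^ k ≠ 1 := fun k h => hαq k (by
    rw [hd] at h; field_simp at h; rw [pow_succ']; linear_combination h)
  have hXC : q / (q ^ M * X) = C := by rw [hX]; field_simp
  have hYD : q / (q ^ M * Y) = D := by rw [hY]; field_simp
  have hdα : q / (q ^ M * d) = α := by rw [hd]; field_simp
  have hqq : q / (q ^ M * q) = (q ^ M)⁻¹ := by field_simp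
  have hdX : d / X = C / α := by rw [hd, hX]; field_simp
  have hdY : d / Y = D / α := by rw [hd, hY]; field_simp
  have hdXY : d / (X * Y) = ε := by
    rw [hd, hX, hY]; field_simp; linear_combination hbal
  have key := saalschutz_coeff hX0 hY0 hq hdq M
  rw [hdX, hdY, hdXY, ← sum_flip] at key
  have hqM := qShifted_self_ne_zero hq M
  have hdM : qShifted d q M ≠ 0 := qShifted_ne_zero fun r _ => hdq r
  have hκ := revFactor_ne_zero hq0 M
  have hCn : ∀ n, qShifted C q n ≠ 0 := fun n => qShifted_ne_zero fun r _ => hCq r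
  have hDn : ∀ n, qShifted D q n ≠ 0 := fun n => qShifted_ne_zero fun r _ => hDq r
  have hterm : ∀ r ∈ range (M + 1),
      qShifted X q (M - r) * qShifted Y q (M - r) * ε ^ (M - r) /
          (qShifted q q (M - r) * qShifted d q (M - r)) *
        (qShifted ε q (M - (M - r)) / qShifted q q (M - (M - r))) =
      qShifted X q M * qShifted Y q M * ε ^ M / (qShifted q q M * qShifted d q M) *
        (qShifted (q ^ M)⁻¹ q r * qShifted α q r * qShifted ε q r /
        (qShifted q q r * qShifted C q r * qShifted D q r) * q ^ r) := by
    intro r hr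
    have hr : r ≤ M := by simpa [Nat.lt_succ_iff] using hr
    rw [Nat.sub_sub_self hr]
    have r1 := qShifted_reverse hX0 hq0 hr
    have r2 := qShifted_reverse hY0 hq0 hr
    have r3 := qShifted_reverse hd0 hq0 hr
    have r4 := qShifted_reverse hq0 hq0 hr
    rw [hXC] at r1
    rw [hYD] at r2
    rw [hdα] at r3
    rw [hqq] at r4
    have hε' : ε ^ M = ε ^ (M - r) * ε ^ r := by rw [← pow_add]; congr 1; omega
    have hε2 : ε ^ r * X ^ r * Y ^ r = d ^ r := by
      rw [← mul_pow, ← mul_pow, ← hdXY]; congr 1; field_simp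
    have hdr : d ^ r ≠ 0 := pow_ne_zero _ hd0
    have n1 := hqM
    have n2 := hdM
    rw [r4] at n1
    rw [r3] at n2
    have m1 := left_ne_zero_of_mul n1
    have m2 := left_ne_zero_of_mul n2
    have m3 := left_ne_zero_of_mul (right_ne_zero_of_mul n1)
    have m4 := left_ne_zero_of_mul (right_ne_zero_of_mul n2)
    have := hCn r
    have := hDn r
    have := qShifted_self_ne_zero hq r
    have := hκ r
    rw [r1, r2, r3, r4, hε', ← hε2]
    have := pow_ne_zero r hX0
    have := pow_ne_zero r hY0
    have := pow_ne_zero r hε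
    generalize qShifted (q ^ M)⁻¹ q r = w at *
    field_simp
  rw [sum_congr rfl hterm, ← mul_sum] at key
  have f1 := qShifted_reverse_full hX0 hq0 M
  have f2 := qShifted_reverse_full hY0 hq0 M
  rw [hXC] at f1
  rw [hYD] at f2
  have hmon : α ^ M * ((X * Y * ε) ^ M * revFactor q M M ^ 2) = 1 := by
    have h1 : X * Y * ε = d := by rw [← hdXY]; field_simp
    have h2 := revFactor_sq hq0 M M
    have h3 : q ^ (M * (M + 1)) ≠ 0 := pow_ne_zero _ hq0
    have h4 : α * d = q / q ^ M := by rw [hd]; field_simp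
    apply mul_right_cancel₀ h3
    rw [h1, ← mul_assoc, ← mul_pow, h4, mul_assoc, h2, one_mul, div_pow, ← pow_mul, div_mul_eq_mul_div,
      div_eq_iff (pow_ne_zero _ hq0), ← pow_add, ← pow_add]
    congr 1; ring
  rw [f1, f2] at key
  have c1 := hCn M
  have c2 := hDn M
  have c3 := hκ M
  have c4 := pow_ne_zero M hX0
  have c5 := pow_ne_zero M hY0
  have c6 := pow_ne_zero M hε
  rw [eq_div_iff (mul_ne_zero c1 c2)]
  rw [mul_pow, mul_pow] at hmon
  rw [eq_div_iff (mul_ne_zero hqM hdM)] at key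
  rw [← key]
  generalize (∑ r ∈ range (M + 1), qShifted (q ^ M)⁻¹ q r * qShifted α q r * qShifted ε q r /
        (qShifted q q r * qShifted C q r * qShifted D q r) * q ^ r) = S
  field_simp
  linear_combination (-S) * hmon

/-- Sears' transformation of terminating balanced `₄φ₃` series. -/
theorem sears {α b c d e f q : ℂ} (n : ℕ) (hq0 : q ≠ 0) (hα : α ≠ 0) (hb : b ≠ 0) (hc : c ≠ 0)
    (hd : d ≠ 0) (he : e ≠ 0) (hf : f ≠ 0)
    (hq : ∀ k : ℕ, q ^ (k + 1) ≠ 1) (hdq : ∀ k : ℕ, d * q ^ k ≠ 1)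
    (heq : ∀ k : ℕ, e * q ^ k ≠ 1) (hfq : ∀ k : ℕ, f * q ^ k ≠ 1)
    (hαq : ∀ k : ℕ, q ^ (k + 1) ≠ q ^ n * α)
    (heα : ∀ k < n, α * q / (q ^ n * e) * q ^ k ≠ 1)
    (hfα : ∀ k < n, α * q / (q ^ n * f) * q ^ k ≠ 1)
    (hbal : d * e * f * q ^ n = α * b * c * q) :
    ∑ k ∈ range (n + 1),
        qShifted (q ^ n)⁻¹ q k * qShifted α q k * (qShifted b q k * qShifted c q k) /
          (qShifted q q k * qShifted d q k * (qShifted e q k * qShifted f q k)) * q ^ k =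
      α ^ n * (qShifted (e / α) q n * qShifted (f / α) q n) / (qShifted e q n * qShifted f q n) *
      ∑ k ∈ range (n + 1),
        qShifted (q ^ n)⁻¹ q k * qShifted α q k * (qShifted (d / b) q k * qShifted (d / c) q k) /
          (qShifted q q k * qShifted d q k * (qShifted (α * q / (q ^ n * e)) q k *
            qShifted (α * q / (q ^ n * f)) q k)) * q ^ k := by
  obtain ⟨ε, hε⟩ : ∃ ε, ε = b * c / d := ⟨_, rfl⟩
  have hX0 : d / b ≠ 0 := div_ne_zero hd hb
  have hY0 : d / c ≠ 0 := div_ne_zero hd hc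
  have hεd : d / (d / b * (d / c)) = ε := by rw [hε]; field_simp
  have hbd : d / (d / b) = b := by field_simp
  have hcd : d / (d / c) = c := by field_simp
  have hef : e * f * q ^ n = α * ε * q := by
    rw [hε]; field_simp; linear_combination hbal
  have hen : ∀ n, qShifted e q n ≠ 0 := fun n => qShifted_ne_zero fun r _ => heq r
  have hfn : ∀ n, qShifted f q n ≠ 0 := fun n => qShifted_ne_zero fun r _ => hfq r
  have hdn : ∀ n, qShifted d q n ≠ 0 := fun n => qShifted_ne_zero fun r _ => hdq r
  have hqn := qShifted_self_ne_zero hq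
  obtain ⟨F, hF⟩ : ∃ F : ℕ → ℕ → ℂ, ∀ j r, F j r =
      qShifted (q ^ n)⁻¹ q (j + r) * qShifted α q (j + r) /
        (qShifted e q (j + r) * qShifted f q (j + r)) * q ^ (j + r) *
        (qShifted (d / b) q j * qShifted (d / c) q j * ε ^ j / (qShifted q q j * qShifted d q j) *
          (qShifted ε q r / qShifted q q r)) := ⟨_, fun _ _ => rfl⟩
  have step1 : ∀ k ∈ range (n + 1),
      qShifted (q ^ n)⁻¹ q k * qShifted α q k * (qShifted b q k * qShifted c q k) /
          (qShifted q q k * qShifted d q k * (qShifted e q k * qShifted f q k)) * q ^ k =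
      ∑ j ∈ range (k + 1), F j (k - j) := by
    intro k _
    have key := saalschutz_coeff hX0 hY0 hq hdq k
    rw [hεd, hbd, hcd] at key
    have : ∀ j ∈ range (k + 1), j + (k - j) = k := fun j hj => by
      have := mem_range.1 hj; omega
    have h : ∀ j ∈ range (k + 1), F j (k - j) = qShifted (q ^ n)⁻¹ q k * qShifted α q k /
        (qShifted e q k * qShifted f q k) * q ^ k *
        (qShifted (d / b) q j * qShifted (d / c) q j * ε ^ j / (qShifted q q j * qShifted d q j) *
          (qShifted ε q (k - j) / qShifted q q (k - j))) := fun j hj => by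
      rw [hF, this j hj]
    rw [sum_congr rfl h, ← mul_sum, key]
    have := hen k
    have := hfn k
    have := hdn k
    have := hqn k
    generalize qShifted (q ^ n)⁻¹ q k = w
    field_simp
  rw [sum_congr rfl step1, sum_range_diag_flip, mul_sum]
  refine sum_congr rfl fun j hj => ?_
  have hj : j ≤ n := by simpa [Nat.lt_succ_iff] using hj
  have hnj : n + 1 - j = n - j + 1 := by omega
  rw [hnj]
  have hqj : q ^ j ≠ 0 := pow_ne_zero _ hq0
  have hqnj : q ^ (n - j) * q ^ j = q ^ n := by rw [← pow_add]; congr 1; omega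
  have hqnj0 : q ^ (n - j) ≠ 0 := pow_ne_zero _ hq0
  have hqn0 : q ^ n ≠ 0 := pow_ne_zero _ hq0
  have hinv : (q ^ n)⁻¹ * q ^ j = (q ^ (n - j))⁻¹ := by
    rw [← hqnj]; field_simp
  have sz := saalschutz (α := α * q ^ j) (ε := ε) (C := e * q ^ j) (D := f * q ^ j) (n - j) hq0
    (mul_ne_zero hα hqj) (mul_ne_zero he hqj) (mul_ne_zero hf hqj) hq
    (fun k => by rw [mul_assoc, ← pow_add]; exact heq _)
    (fun k => by rw [mul_assoc, ← pow_add]; exact hfq _)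
    (fun k => by rw [mul_comm α, ← mul_assoc, hqnj]; exact hαq k)
    (by linear_combination (e * f * q ^ j) * hqnj + q ^ j * hef)
  rw [mul_div_mul_right _ _ hqj, mul_div_mul_right _ _ hqj] at sz
  have step2 : ∀ r ∈ range (n - j + 1),
      F j r =
      qShifted (q ^ n)⁻¹ q j * qShifted α q j / (qShifted e q j * qShifted f q j) * q ^ j *
        (qShifted (d / b) q j * qShifted (d / c) q j * ε ^ j / (qShifted q q j * qShifted d q j)) *
      (qShifted (q ^ (n - j))⁻¹ q r * qShifted (α * q ^ j) q r * qShifted ε q r /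
        (qShifted q q r * qShifted (e * q ^ j) q r * qShifted (f * q ^ j) q r) * q ^ r) := by
    intro r _
    rw [hF]
    simp only [qShifted_add _ _ j r, hinv, pow_add]
    ring
  rw [sum_congr rfl step2, ← mul_sum, sz]
  have a1 : qShifted e q n = qShifted e q j * qShifted (e * q ^ j) q (n - j) := by
    rw [← qShifted_add]; congr 1; omega
  have a2 : qShifted f q n = qShifted f q j * qShifted (f * q ^ j) q (n - j) := by
    rw [← qShifted_add]; congr 1; omega
  have ee : q / (q ^ n * (e / α)) = α * q / (q ^ n * e) := by field_simp
  have ff : q / (q ^ n * (f / α)) = α * q / (q ^ n * f) := by field_simp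
  have b1 := qShifted_sub (div_ne_zero he hα) hq0 hj (by rw [ee]; exact fun k hk => heα k (by omega))
  have b2 := qShifted_sub (div_ne_zero hf hα) hq0 hj (by rw [ff]; exact fun k hk => hfα k (by omega))
  rw [ee] at b1
  rw [ff] at b2
  have n1 := hen n
  have n2 := hfn n
  rw [a1] at n1
  rw [a2] at n2
  have := left_ne_zero_of_mul n1
  have := left_ne_zero_of_mul n2
  have := right_ne_zero_of_mul n1
  have := right_ne_zero_of_mul n2
  have := hqn j
  have := hdn j
  have c1 : qShifted (α * q / (q ^ n * e)) q j ≠ 0 := qShifted_ne_zero fun r hr => heα r (by omega)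
  have c2 : qShifted (α * q / (q ^ n * f)) q j ≠ 0 := qShifted_ne_zero fun r hr => hfα r (by omega)
  have hκ := revFactor_ne_zero hq0 n j
  have hmon : (α * q ^ j) ^ (n - j) * (α ^ j * α ^ j) * ε ^ j =
      α ^ n * (e ^ j * f ^ j * revFactor q n j ^ 2) := by
    have h3 : q ^ (j * (j + 1)) ≠ 0 := pow_ne_zero _ hq0
    have h4 : (q ^ n) ^ j ≠ 0 := pow_ne_zero _ hqn0
    have h5 : (e * f * q ^ n) ^ j = (α * ε * q) ^ j := by rw [hef]
    have hαn : α ^ n = α ^ (n - j) * α ^ j := by rw [← pow_add]; congr 1; omega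
    apply mul_right_cancel₀ h3
    have h6 : revFactor q n j ^ 2 * q ^ (j * (j + 1)) = (q ^ n) ^ j * (q ^ n) ^ j := by
      rw [revFactor_sq hq0]; ring
    have h7 : q ^ (j * (n - j)) * q ^ (j * (j + 1)) = (q ^ n) ^ j * q ^ j := by
      rw [← pow_add, ← mul_add, ← pow_mul, ← pow_add]; congr 1
      obtain ⟨s, rfl⟩ := Nat.exists_eq_add_of_le hj
      rw [Nat.add_sub_cancel_left]; ring
    simp only [mul_pow] at h5
    rw [mul_pow, ← pow_mul, hαn]
    linear_combination (α ^ (n - j) * α ^ j * α ^ j * ε ^ j) * h7 -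
      (α ^ (n - j) * α ^ j * e ^ j * f ^ j) * h6 -
      (α ^ (n - j) * α ^ j * (q ^ n) ^ j) * h5
  rw [b1, b2, a1, a2, div_pow, div_pow]
  have := pow_ne_zero j he
  have := pow_ne_zero j hf
  have := pow_ne_zero j hα
  generalize hu : (α * q ^ j) ^ (n - j) = u at *
  generalize qShifted (e * q ^ j) q (n - j) = w₁ at *
  generalize qShifted (f * q ^ j) q (n - j) = w₂ at *
  generalize qShifted (q ^ n)⁻¹ q j = w₃
  generalize qShifted (α * q / (q ^ n * e)) q j = w₄ at *
  generalize qShifted (α * q / (q ^ n * f)) q j = w₅ at *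
  field_simp
  linear_combination (w₃ * qShifted α q j * qShifted (d / b) q j * qShifted (d / c) q j *
    qShifted (e / α) q n * qShifted (f / α) q n) * hmon

theorem qShifted_mul_qShifted_neg (x q : ℂ) (n : ℕ) :
    qShifted x q n * qShifted (-x) q n = qShifted (x ^ 2) (q ^ 2) n := by
  simp only [qShifted, ← prod_mul_distrib]
  refine prod_congr rfl fun k _ => ?_
  ring

/-- `(y q ^ (-i); q)_k` in terms of `(y; q)_k`; both `(y q ^ (-i); q)_i` and `(y q ^ (k - i); q)_i`
are reversed. -/
theorem qShifted_div_pow {y q : ℂ} (hy : y ≠ 0) (hq0 : q ≠ 0) (i k : ℕ) :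
    qShifted (y / q ^ i) q k * (qShifted (q / (y * q ^ k)) q i * q ^ (k * i)) =
      qShifted y q k * qShifted (q / y) q i := by
  induction i with
  | zero => simp [qShifted_zero]
  | succ i ih =>
    have hi := pow_ne_zero i hq0
    have hk := pow_ne_zero k hq0
    have h1 : qShifted (y / q ^ (i + 1)) q k * (1 - y / q ^ (i + 1) * q ^ k) =
        (1 - y / q ^ (i + 1)) * qShifted (y / q ^ i) q k := by
      rw [← qShifted_succ, qShifted_succ']
      congr 2
      rw [pow_succ]; field_simp
    have h2 : (1 - q / (y * q ^ k) * q ^ i) * q ^ k =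
        (1 - y / q ^ (i + 1) * q ^ k) * -(q ^ (i + 1) / y) := by
      rw [pow_succ]; field_simp; ring
    have h3 : (1 - q / y * q ^ i) = (1 - y / q ^ (i + 1)) * -(q ^ (i + 1) / y) := by
      rw [pow_succ]; field_simp; ring
    rw [qShifted_succ _ _ i, qShifted_succ _ _ i, h3, mul_add_one, pow_add q (k * i)]
    linear_combination (qShifted (y / q ^ (i + 1)) q k * qShifted (q / (y * q ^ k)) q i *
      q ^ (k * i)) * h2 + (-(q ^ (i + 1) / y)) * qShifted (q / (y * q ^ k)) q i *
      q ^ (k * i) * h1 + (1 - y / q ^ (i + 1)) * (-(q ^ (i + 1) / y)) * ih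

theorem revFactor_mul_pow {q : ℂ} (hq0 : q ≠ 0) (M r : ℕ) :
    revFactor q M r * q ^ ((r + 1).choose 2) = (-1) ^ r * q ^ (M * r) := by
  induction r with
  | zero => simp [revFactor]
  | succ r ih =>
    have h : (r + 1 + 1).choose 2 = (r + 1).choose 2 + (r + 1) := by
      rw [Nat.choose_succ_succ' (r + 1) 1, Nat.choose_one_right, add_comm]
    rw [revFactor, prod_range_succ, ← revFactor, h, pow_add q, mul_add_one, pow_add q (M * r),
      pow_succ (-1 : ℂ)]
    have := pow_ne_zero (r + 1) hq0
    have h2 : -(q ^ M / q ^ (r + 1)) * q ^ (r + 1) = -q ^ M := by field_simp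
    linear_combination (revFactor q M r * q ^ ((r + 1).choose 2)) * h2 - q ^ M * ih

/-- `(q ^ (-k); q)_j = (-1) ^ j q ^ (j (j - 1) / 2 - k j) (q; q)_k / (q; q)_{k - j}` for
`k = j + r`, without division. -/
theorem qShifted_inv_pow_mul {q : ℂ} (hq0 : q ≠ 0) (j r : ℕ) :
    qShifted (q ^ (j + r))⁻¹ q j * q ^ ((j + r) * j) * qShifted q q r * q ^ j =
      qShifted q q (j + r) * ((-1) ^ j * q ^ ((j + 1).choose 2)) := by
  have h := qShifted_reverse hq0 hq0 (Nat.le_add_right j r)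
  rw [Nat.add_sub_cancel_left] at h
  have e : q / (q ^ (j + r) * q) = (q ^ (j + r))⁻¹ := by field_simp
  rw [e] at h
  have hr := revFactor_mul_pow hq0 (j + r) j
  have hs : ((-1 : ℂ) ^ j) * (-1) ^ j = 1 := by rw [← mul_pow]; simp
  rw [h]
  linear_combination (-(qShifted q q r * qShifted (q ^ (j + r))⁻¹ q j * q ^ j * (-1) ^ j)) * hr -
    (qShifted q q r * qShifted (q ^ (j + r))⁻¹ q j * q ^ j * q ^ ((j + r) * j)) * hs

/-! ### Reduction to the `q`-Watson sum -/

/-- The coefficient of the `j`-th `q`-Watson series in the expansion of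
`₄φ₃(q ^ (-n), -q ^ (-m - n), u, v; c, -c, q ^ (-m - 2 n))`, where `c ^ 2 = q u v`. -/
noncomputable def watsonCoeff (u v q : ℂ) (m n j : ℕ) : ℂ :=
  (-1) ^ j * q ^ ((j + 1).choose 2) / q ^ (n * j) *
    (qShifted (q ^ m)⁻¹ q j * qShifted (q ^ (m + n))⁻¹ q j * qShifted (-(q ^ (m + n))⁻¹) q j *
        qShifted u q j * qShifted v q j /
      (qShifted q q j * qShifted (q * u * v) (q ^ 2) j * qShifted (q ^ (m + 2 * n))⁻¹ q j *
        qShifted (q ^ j / q ^ (2 * (m + n) + 1)) q j))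

theorem inv_pow_shift {q : ℂ} (hq0 : q ≠ 0) {M j : ℕ} (h : j ≤ M) :
    (q ^ M)⁻¹ * q ^ j = (q ^ (M - j))⁻¹ := by
  have : q ^ M = q ^ (M - j) * q ^ j := by rw [← pow_add]; congr 1; omega
  rw [this]
  have := pow_ne_zero j hq0
  have := pow_ne_zero (M - j) hq0
  field_simp

/-- The very-well-poised part of the expansion regroups by splitting `(A; q)_{2j+1+r}` in two
ways. -/
theorem vwp_split {A q : ℂ} (j r : ℕ) :
    (1 - A) * qShifted (A * q) q (j + r) * qShifted (A * q ^ (j + r + 1)) q j =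
      qShifted A q j * qShifted (A * q ^ j) q j * (1 - A * q ^ (2 * j)) *
        qShifted (A * q ^ (2 * j + 1)) q r := by
  rw [← qShifted_succ', ← qShifted_add]
  have e1 : j + r + 1 + j = j + j + 1 + r := by ring
  rw [e1, qShifted_add, qShifted_succ, qShifted_add]
  have e2 : 2 * j = j + j := by ring
  rw [e2]

/-- The `j`-th term of the `₆φ₅` expansion, times the remaining factors of the `k`-th term of the
series with `k = j + r`, is a multiple of the `r`-th term of a `q`-Watson series. -/
theorem vwpTerm_mul_eq_watsonTerm {u v q : ℂ} (hq0 : q ≠ 0)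
    (hq : ∀ k : ℕ, q ^ (k + 1) ≠ 1) (huv : ∀ k : ℕ, q * u * v * (q ^ 2) ^ k ≠ 1)
    (m n j r : ℕ) (hjr : j + r ≤ m + n) :
    qShifted (q ^ (m + n))⁻¹ q (j + r) / qShifted (q ^ (2 * (m + n)))⁻¹ q (j + r) *
        vwpTerm (q ^ (2 * (m + n) + 1))⁻¹ (q ^ (m + n))⁻¹ (q ^ m)⁻¹ q (j + r) j *
        (qShifted (-(q ^ (m + n))⁻¹) q (j + r) * (qShifted u q (j + r) * qShifted v q (j + r)) /
          (qShifted q q (j + r) * qShifted (q * u * v) (q ^ 2) (j + r)) * q ^ (j + r)) =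
      watsonCoeff u v q m n j * watsonTerm (u * q ^ j) (v * q ^ j) q (m + n - j) r := by
  obtain ⟨A, hA⟩ : ∃ A, A = (q ^ (2 * (m + n) + 1))⁻¹ := ⟨_, rfl⟩
  obtain ⟨B, hB⟩ : ∃ B, B = (q ^ (m + n))⁻¹ := ⟨_, rfl⟩
  have hp : ∀ k, q ^ k ≠ 0 := fun k => pow_ne_zero k hq0
  have hne := fun M r (h : r < M) => inv_pow_mul_pow_ne_one hq0 hq (M := M) (r := r) h
  have hAq : (q ^ (2 * (m + n)))⁻¹ = A * q := by
    rw [hA, pow_succ]; have := hp (2 * (m + n)); field_simp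
  have hAB : A * q / B = B := by
    rw [← hAq, hB, two_mul, pow_add]; have := hp (m + n); field_simp
  have hAm : A * q / (q ^ m)⁻¹ = (q ^ (m + 2 * n))⁻¹ := by
    rw [← hAq]
    have e : q ^ (2 * (m + n)) = q ^ m * q ^ (m + 2 * n) := by rw [← pow_add]; congr 1; ring
    rw [e]; have := hp m; have := hp (m + 2 * n); field_simp
  have hAz : A * q ^ (j + r + 1) / (B * (q ^ m)⁻¹) = q ^ (j + r) / q ^ n := by
    rw [pow_succ' q (j + r), ← mul_assoc, ← hAq, hB]
    have e : q ^ (2 * (m + n)) = q ^ (m + n) * q ^ m * q ^ n := by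
      rw [← pow_add, ← pow_add]; congr 1; ring
    rw [e]; have := hp m; have := hp n; have := hp (m + n); field_simp
  have hAj : q ^ j / q ^ (2 * (m + n) + 1) = A * q ^ j := by rw [hA]; ring
  have hA2 : (q ^ (2 * (m + n - j)))⁻¹ = A * q ^ (2 * j + 1) := by
    rw [hA, inv_pow_shift hq0 (by omega)]; congr 3; omega
  have hBj : (q ^ (m + n - j))⁻¹ = B * q ^ j := by
    rw [hB, inv_pow_shift hq0 (by omega)]
  have hBj' : -(B * q ^ j) = -B * q ^ j := by ring
  have huvj : q * (u * q ^ j) * (v * q ^ j) = q * u * v * (q ^ 2) ^ j := by ring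
  have d1 := qShifted_self_ne_zero hq
  have d2 : ∀ n, qShifted (q * u * v) (q ^ 2) n ≠ 0 := fun n => qShifted_ne_zero fun k _ => huv k
  have hB1 : qShifted B q j ≠ 0 := by
    rw [hB]; exact qShifted_ne_zero fun k hk => hne _ _ (by omega)
  have hA1 : 1 - A ≠ 0 := by
    have := hne (2 * (m + n) + 1) 0 (by omega)
    rw [pow_zero, mul_one, ← hA] at this
    exact sub_ne_zero.2 this.symm
  have s1 : qShifted (A * q) q (j + r) ≠ 0 := by
    rw [← hAq]; exact qShifted_ne_zero fun k hk => hne _ _ (by omega)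
  have s2 : qShifted (A * q ^ (j + r + 1)) q j ≠ 0 := qShifted_ne_zero fun k hk => by
    rw [hA, mul_assoc, ← pow_add]; exact hne _ _ (by omega)
  have split := vwp_split (A := A) (q := q) j r
  have s3 := mul_ne_zero (mul_ne_zero hA1 s1) s2
  rw [split] at s3
  have hinv := qShifted_inv_pow_mul hq0 j r
  rw [← hA, ← hB]
  simp only [vwpTerm, watsonCoeff, watsonTerm]
  rw [hAB, hAm, hAz, hAq, ← hB, hA2, hBj, hBj', huvj, hAj]
  have e5 : qShifted (q * u * v) (q ^ 2) (j + r) =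
    qShifted (q * u * v) (q ^ 2) j * qShifted (q * u * v * (q ^ 2) ^ j) (q ^ 2) r := qShifted_add ..
  have d2j := d2 (j + r)
  rw [e5] at d2j ⊢
  have d2a := left_ne_zero_of_mul d2j
  have d2b := right_ne_zero_of_mul d2j
  rw [qShifted_add B, qShifted_add (-B), qShifted_add u, qShifted_add v]
  have d1a := d1 j
  have d1b := d1 r
  have d1c := d1 (j + r)
  generalize qShifted (q ^ (j + r))⁻¹ q j = x7 at *
  rw [div_pow, ← pow_mul, ← pow_mul, pow_add q j r]
  have hn := hp (n * j)
  generalize qShifted (q * u * v * (q ^ 2) ^ j) (q ^ 2) r = x1 at *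
  generalize qShifted (q * u * v) (q ^ 2) j = x2 at *
  generalize qShifted (A * q) q (j + r) = x3 at *
  generalize qShifted (A * q ^ (j + r + 1)) q j = x4 at *
  generalize qShifted (A * q ^ j) q j = x5 at *
  generalize qShifted (A * q ^ (2 * j + 1)) q r = x6 at *
  generalize qShifted q q j = x8 at *
  generalize qShifted q q r = x9 at *
  generalize qShifted q q (j + r) = x10 at *
  generalize qShifted B q j = x11 at *
  generalize qShifted (q ^ (m + 2 * n))⁻¹ q j = x12 at *
  generalize qShifted (q ^ m)⁻¹ q j = x13 at *
  generalize qShifted (B * q ^ j) q r = x14 at *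
  generalize qShifted (-B * q ^ j) q r = x15 at *
  generalize qShifted (-B) q j = x16 at *
  generalize qShifted (u * q ^ j) q r = x17 at *
  generalize qShifted (v * q ^ j) q r = x18 at *
  generalize qShifted u q j = x19 at *
  generalize qShifted v q j = x20 at *
  generalize qShifted A q j = x21 at *
  generalize q ^ (n * j) = Q at *
  generalize q ^ ((j + r) * j) = R at *
  generalize (-1 : ℂ) ^ j * q ^ ((j + 1).choose 2) = T at *
  generalize q ^ j = Qj at *
  generalize q ^ r = Qr at *
  generalize 1 - A * q ^ (2 * j) = y1 at *
  generalize 1 - A = y2 at *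
  have h1 : y1 * x21 / (y2 * x3 * x4) = 1 / (x5 * x6) := by
    rw [split]
    have := right_ne_zero_of_mul (left_ne_zero_of_mul s3)
    have := left_ne_zero_of_mul (left_ne_zero_of_mul (left_ne_zero_of_mul s3))
    field_simp
  have h2 : x7 * R * Qj / x10 = T / x9 := by
    rw [div_eq_div_iff d1c d1b]; linear_combination hinv
  have h3 : x11 / x11 = 1 := div_self hB1
  calc _ = (y1 * x21 / (y2 * x3 * x4)) * (x7 * R * Qj / x10) * (x11 / x11) *
        (x11 * x14 * x13 / (x8 * x12 * Q) * (x16 * x15 * (x19 * x17 * (x20 * x18))) / (x2 * x1) *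
          Qr) := by ring
    _ = _ := by rw [h1, h2, h3]; ring

/-- The series with parameters `q ^ (-n)`, `-q ^ (-m - n)` and `q ^ (-m - 2 n)` is a combination of
series summable by the `q`-Watson formula: expand `(q ^ (-n))_k / (q ^ (-m - 2 n))_k` by the
terminating `₆φ₅` sum and shift the summation index. -/
theorem sum_eq_sum_watsonCoeff {u v q : ℂ} (hq0 : q ≠ 0)
    (hq : ∀ k : ℕ, q ^ (k + 1) ≠ 1) (huv : ∀ k : ℕ, q * u * v * (q ^ 2) ^ k ≠ 1) (m n : ℕ) :
    ∑ k ∈ range (n + 1), qShifted (q ^ n)⁻¹ q k * qShifted (-(q ^ (m + n))⁻¹) q k *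
        (qShifted u q k * qShifted v q k) /
        (qShifted q q k * qShifted (q * u * v) (q ^ 2) k * qShifted (q ^ (m + 2 * n))⁻¹ q k) *
        q ^ k =
      ∑ j ∈ range (m + 1), watsonCoeff u v q m n j *
        (qShifted (q * (u * q ^ j)) (q ^ 2) (m + n - j) *
          qShifted (q * (v * q ^ j)) (q ^ 2) (m + n - j) /
        (qShifted q (q ^ 2) (m + n - j) *
          qShifted (q * (u * q ^ j) * (v * q ^ j)) (q ^ 2) (m + n - j))) := by
  have hp : ∀ k, q ^ k ≠ 0 := fun k => pow_ne_zero k hq0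
  have hne := fun M r (h : r < M) => inv_pow_mul_pow_ne_one hq0 hq (M := M) (r := r) h
  obtain ⟨F, hF⟩ : ∃ F : ℕ → ℕ → ℂ, ∀ j r, F j r =
    qShifted (q ^ (m + n))⁻¹ q (j + r) / qShifted (q ^ (2 * (m + n)))⁻¹ q (j + r) *
        vwpTerm (q ^ (2 * (m + n) + 1))⁻¹ (q ^ (m + n))⁻¹ (q ^ m)⁻¹ q (j + r) j *
        (qShifted (-(q ^ (m + n))⁻¹) q (j + r) * (qShifted u q (j + r) * qShifted v q (j + r)) /
          (qShifted q q (j + r) * qShifted (q * u * v) (q ^ 2) (j + r)) * q ^ (j + r)) :=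
    ⟨_, fun _ _ => rfl⟩
  have hAq : (q ^ (2 * (m + n) + 1))⁻¹ * q = (q ^ (2 * (m + n)))⁻¹ := by
    rw [pow_succ]; have := hp (2 * (m + n)); field_simp
  have hAB : (q ^ (2 * (m + n)))⁻¹ / (q ^ (m + n))⁻¹ = (q ^ (m + n))⁻¹ := by
    rw [two_mul, pow_add]; have := hp (m + n); field_simp
  have hAm : (q ^ (2 * (m + n)))⁻¹ / (q ^ m)⁻¹ = (q ^ (m + 2 * n))⁻¹ := by
    have e : q ^ (2 * (m + n)) = q ^ m * q ^ (m + 2 * n) := by rw [← pow_add]; congr 1; ring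
    rw [e]; have := hp m; have := hp (m + 2 * n); field_simp
  have hABm : (q ^ (2 * (m + n)))⁻¹ / ((q ^ (m + n))⁻¹ * (q ^ m)⁻¹) = (q ^ n)⁻¹ := by
    have e : q ^ (2 * (m + n)) = q ^ (m + n) * q ^ m * q ^ n := by
      rw [← pow_add, ← pow_add]; congr 1; ring
    rw [e]; have := hp m; have := hp n; have := hp (m + n); field_simp
  have step1 : ∀ k ∈ range (m + n + 1),
      qShifted (q ^ n)⁻¹ q k * qShifted (-(q ^ (m + n))⁻¹) q k *
        (qShifted u q k * qShifted v q k) /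
        (qShifted q q k * qShifted (q * u * v) (q ^ 2) k * qShifted (q ^ (m + 2 * n))⁻¹ q k) *
        q ^ k = ∑ j ∈ range (k + 1), F j (k - j) := by
    intro k hk
    have hk : k ≤ m + n := by simpa [Nat.lt_succ_iff] using hk
    have key := sum_vwpTerm (A := (q ^ (2 * (m + n) + 1))⁻¹) (b := (q ^ (m + n))⁻¹)
      (c := (q ^ m)⁻¹) hq0 (inv_ne_zero (hp _)) (inv_ne_zero (hp _)) hq k
      (fun r hr => hne _ _ (by omega))
      (fun r hr => by rw [hAq, hAB]; exact hne _ _ (by omega))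
      (fun r hr => by rw [hAq, hAm]; exact hne _ _ (by omega))
    rw [hAq, hAB, hAm, hABm] at key
    have : ∀ j ∈ range (k + 1), j + (k - j) = k := fun j hj => by
      have := mem_range.1 hj; omega
    have h : ∀ j ∈ range (k + 1), F j (k - j) =
        qShifted (q ^ (m + n))⁻¹ q k / qShifted (q ^ (2 * (m + n)))⁻¹ q k *
        vwpTerm (q ^ (2 * (m + n) + 1))⁻¹ (q ^ (m + n))⁻¹ (q ^ m)⁻¹ q k j *
        (qShifted (-(q ^ (m + n))⁻¹) q k * (qShifted u q k * qShifted v q k) /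
          (qShifted q q k * qShifted (q * u * v) (q ^ 2) k) * q ^ k) := fun j hj => by
      rw [hF, this j hj]
    rw [sum_congr rfl h, ← sum_mul, ← mul_sum, key]
    have d1 : qShifted (q ^ (m + n))⁻¹ q k ≠ 0 :=
      qShifted_ne_zero fun r hr => hne _ _ (by omega)
    have d2 : qShifted (q ^ (2 * (m + n)))⁻¹ q k ≠ 0 :=
      qShifted_ne_zero fun r hr => hne _ _ (by omega)
    generalize qShifted (q ^ (m + n))⁻¹ q k = x1 at *
    generalize qShifted (q ^ (2 * (m + n)))⁻¹ q k = x2 at *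
    have h3 : x1 / x1 = 1 := div_self d1
    have h4 : x2 / x2 = 1 := div_self d2
    linear_combination (-(qShifted (q ^ n)⁻¹ q k * qShifted (-(q ^ (m + n))⁻¹) q k *
        (qShifted u q k * qShifted v q k) /
        (qShifted q q k * qShifted (q * u * v) (q ^ 2) k * qShifted (q ^ (m + 2 * n))⁻¹ q k) *
        q ^ k)) * (h3 + x1 / x1 * h4)
  have hext : ∀ k ∈ range (m + n + 1), k ∉ range (n + 1) →
      qShifted (q ^ n)⁻¹ q k * qShifted (-(q ^ (m + n))⁻¹) q k *
        (qShifted u q k * qShifted v q k) /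
        (qShifted q q k * qShifted (q * u * v) (q ^ 2) k * qShifted (q ^ (m + 2 * n))⁻¹ q k) *
        q ^ k = 0 := fun k _ hk => by
    rw [qShifted_inv_pow_eq_zero hq0 (by simpa using hk)]; simp
  -- Up to `k = m + n` the added terms vanish, and all inner sums then have full length.
  rw [sum_subset (range_subset_range.2 (by omega)) hext, sum_congr rfl step1, sum_range_diag_flip]
  have hext2 : ∀ j ∈ range (m + n + 1), j ∉ range (m + 1) → watsonCoeff u v q m n j *
        (qShifted (q * (u * q ^ j)) (q ^ 2) (m + n - j) *
          qShifted (q * (v * q ^ j)) (q ^ 2) (m + n - j) /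
        (qShifted q (q ^ 2) (m + n - j) *
          qShifted (q * (u * q ^ j) * (v * q ^ j)) (q ^ 2) (m + n - j))) = 0 := fun j _ hj => by
    rw [watsonCoeff, qShifted_inv_pow_eq_zero hq0 (by simpa using hj)]; simp
  rw [sum_subset (range_subset_range.2 (by omega)) hext2]
  refine sum_congr rfl fun j hj => ?_
  have hj : j ≤ m + n := by simpa [Nat.lt_succ_iff] using hj
  have hnj : m + n + 1 - j = m + n - j + 1 := by omega
  rw [hnj, ← sum_watsonTerm hq0 hq (fun k => by
    have : q * (u * q ^ j) * (v * q ^ j) * (q ^ 2) ^ k = q * u * v * (q ^ 2) ^ (j + k) := by ring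
    rw [this]; exact huv _), mul_sum]
  refine sum_congr rfl fun r hr => ?_
  have hr : r ≤ m + n - j := by simpa [Nat.lt_succ_iff] using hr
  rw [hF, vwpTerm_mul_eq_watsonTerm hq0 hq huv m n j r (by omega)]

/-! ### The identity for generic parameters -/

/-- `q` is not a root of unity, and none of `a ^ 2`, `c ^ 2`, `(a c) ^ 2` is an integral power of
`q`. -/
structure IsGeneric (a c q : ℂ) : Prop where
  q_ne : q ≠ 0
  a_ne : a ≠ 0
  c_ne : c ≠ 0
  hq : ∀ k : ℕ, q ^ (k + 1) ≠ 1
  ha : ∀ s t : ℕ, a ^ 2 * q ^ s ≠ q ^ t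
  hc : ∀ s t : ℕ, c ^ 2 * q ^ s ≠ q ^ t
  hac : ∀ s t : ℕ, (a * c) ^ 2 * q ^ s ≠ q ^ t

namespace IsGeneric

variable {a c q : ℂ}

theorem pow_ne_neg_pow (h : IsGeneric a c q) (s t : ℕ) : q ^ s ≠ -q ^ t := by
  intro e
  have hp : ∀ k, q ^ k ≠ 0 := fun k => pow_ne_zero k h.q_ne
  have key : ∀ k, q ^ k ≠ -1 := fun k hk => by
    rcases k with _ | k
    · norm_num at hk
    · apply h.hq (2 * k + 1)
      have : q ^ (2 * k + 1 + 1) = (q ^ (k + 1)) ^ 2 := by ring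
      rw [this, hk]; norm_num
  rcases le_total s t with hst | hst
  · obtain ⟨r, rfl⟩ := Nat.exists_eq_add_of_le hst
    apply key r
    apply mul_left_cancel₀ (hp s)
    rw [pow_add] at e
    linear_combination e
  · obtain ⟨r, rfl⟩ := Nat.exists_eq_add_of_le hst
    apply key r
    apply mul_left_cancel₀ (hp t)
    rw [pow_add] at e
    linear_combination e

theorem c_mul_pow_ne (h : IsGeneric a c q) (s t : ℕ) : c * q ^ s ≠ q ^ t := fun e =>
  h.hc (2 * s) (2 * t) (by rw [pow_mul', pow_mul', ← e]; ring)

theorem c_mul_pow_ne_neg (h : IsGeneric a c q) (s t : ℕ) : c * q ^ s ≠ -q ^ t := fun e =>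
  h.hc (2 * s) (2 * t) (by
    rw [pow_mul', pow_mul']; linear_combination (c * q ^ s - q ^ t) * e)

theorem a_mul_pow_ne (h : IsGeneric a c q) (s t : ℕ) : a * q ^ s ≠ q ^ t := fun e =>
  h.ha (2 * s) (2 * t) (by rw [pow_mul', pow_mul', ← e]; ring)

theorem ac_mul_pow_ne (h : IsGeneric a c q) (s t : ℕ) : a * c * q ^ s ≠ q ^ t := fun e =>
  h.hac (2 * s) (2 * t) (by rw [pow_mul', pow_mul', ← e]; ring)

theorem neg (h : IsGeneric a c q) : IsGeneric (-a) (-c) q where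
  q_ne := h.q_ne
  a_ne := neg_ne_zero.2 h.a_ne
  c_ne := neg_ne_zero.2 h.c_ne
  hq := h.hq
  ha s t := by rw [neg_sq]; exact h.ha s t
  hc s t := by rw [neg_sq]; exact h.hc s t
  hac s t := by rw [neg_mul_neg]; exact h.hac s t

end IsGeneric

/-- The coefficient of the `i`-th series in the expansion of the series with numerator parameters
`y q ^ (-l)`, `q / y` and denominator parameter `w q ^ (-l)` in series with numerator parameters
`y q ^ (-i)`, `q ^ (1 + i) / y` and denominator parameter `w`. -/
noncomputable def shiftCoeff (y w q : ℂ) (l i : ℕ) : ℂ :=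
  (1 - q / y ^ 2 * q ^ (2 * i)) / (1 - q / y ^ 2) *
    (qShifted (q / y ^ 2) q i * qShifted (w / y) q i * qShifted (q ^ l)⁻¹ q i /
      (qShifted q q i * qShifted (q ^ 2 / (y * w)) q i * qShifted (q / y ^ 2 * q ^ (l + 1)) q i)) *
    (q ^ (l + 1) / w) ^ i

/-- The `₆φ₅` sum with parameters `q / y ^ 2; q ^ (k + 1) / y, w / y, q ^ (-l)`, read as an
expansion that removes `l` from the parameters of the `k`-th term of a series. -/
theorem qShifted_shift_expansion {y w q : ℂ} (h : IsGeneric y w q) (l k : ℕ) :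
    qShifted (y / q ^ l) q k * qShifted (q / y) q k / qShifted (w / q ^ l) q k =
      qShifted (q / y) q l * qShifted (q ^ 2 / (y * w)) q l /
        (qShifted (q ^ 2 / y ^ 2) q l * qShifted (q / w) q l) *
      ∑ i ∈ range (l + 1), shiftCoeff y w q l i *
        (qShifted (y / q ^ i) q k * qShifted (q / y * q ^ i) q k / qShifted w q k) := by
  have hq0 := h.q_ne
  have hy := h.a_ne
  have hw := h.c_ne
  have hp : ∀ k, q ^ k ≠ 0 := fun k => pow_ne_zero k hq0
  have hk := hp k
  have eB : q / y ^ 2 * q / (q / y * q ^ k) = q / (y * q ^ k) := by field_simp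
  have eC : q / y ^ 2 * q / (w / y) = q ^ 2 / (y * w) := by field_simp
  have eBC : q / y ^ 2 * q / (q / y * q ^ k * (w / y)) = q / (w * q ^ k) := by field_simp
  have eA : q / y ^ 2 * q = q ^ 2 / y ^ 2 := by ring
  have eZ : q / y ^ 2 * q ^ (l + 1) / (q / y * q ^ k * (w / y)) = q ^ (l + 1) / w / q ^ k := by
    field_simp
  have nB : ∀ r : ℕ, q / (y * q ^ k) * q ^ r ≠ 1 := fun r e => by
    field_simp at e
    exact h.a_mul_pow_ne k (r + 1) (by rw [pow_succ]; linear_combination -e)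
  have nC : ∀ r : ℕ, q ^ 2 / (y * w) * q ^ r ≠ 1 := fun r e => by
    field_simp at e
    exact h.ac_mul_pow_ne 0 (r + 2) (by rw [pow_add]; linear_combination -e)
  have nW : ∀ r : ℕ, q / w * q ^ r ≠ 1 := fun r e => by
    field_simp at e
    exact h.c_mul_pow_ne 0 (r + 1) (by rw [pow_add]; linear_combination -e)
  have nW' : ∀ r : ℕ, w / q ^ l * q ^ r ≠ 1 := fun r e => by
    have := hp l
    field_simp at e
    exact h.c_mul_pow_ne r l (by linear_combination e)
  have nw : ∀ r : ℕ, w * q ^ r ≠ 1 := fun r e => h.c_mul_pow_ne r 0 (by simpa using e)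
  have ny : ∀ r : ℕ, y * q ^ r ≠ 1 := fun r e => h.a_mul_pow_ne r 0 (by simpa using e)
  have nY : ∀ r : ℕ, q / y * q ^ r ≠ 1 := fun r e => by
    field_simp at e
    exact h.a_mul_pow_ne 0 (r + 1) (by rw [pow_add]; linear_combination -e)
  have nA : ∀ r : ℕ, q / y ^ 2 * q ^ r ≠ 1 := fun r e => by
    field_simp at e
    exact h.ha 0 (r + 1) (by rw [pow_add]; linear_combination -e)
  have nA' : ∀ r : ℕ, q ^ 2 / y ^ 2 * q ^ r ≠ 1 := fun r e => nA (r + 1) (by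
    rw [← e]; ring)
  have key := sum_vwpTerm (A := q / y ^ 2) (b := q / y * q ^ k) (c := w / y) hq0
    (mul_ne_zero (div_ne_zero hq0 hy) hk) (div_ne_zero hw hy) h.hq l (fun r _ => nA r)
    (fun r _ => by rw [eB]; exact nB r) (fun r _ => by rw [eC]; exact nC r)
  rw [eB, eC, eBC, eA] at key
  have hterm : ∀ i ∈ range (l + 1), vwpTerm (q / y ^ 2) (q / y * q ^ k) (w / y) q l i *
      (qShifted y q k * qShifted (q / y) q k) =
      shiftCoeff y w q l i * (qShifted (y / q ^ i) q k * qShifted (q / y * q ^ i) q k) := by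
    intro i _
    have s1 := qShifted_div_pow hy hq0 i k
    have s2 : qShifted (q / y) q i * qShifted (q / y * q ^ i) q k =
        qShifted (q / y) q k * qShifted (q / y * q ^ k) q i := by
      rw [← qShifted_add, ← qShifted_add, add_comm]
    have d1 : qShifted (q / (y * q ^ k)) q i ≠ 0 := qShifted_ne_zero fun r _ => nB r
    have d2 : qShifted (q / y) q i ≠ 0 := qShifted_ne_zero fun r _ => nY r
    simp only [vwpTerm, shiftCoeff, eB, eC, eZ, div_pow _ (q ^ k), ← pow_mul]
    have hki := hp (k * i)
    have s3 : qShifted (q / y * q ^ k) q i / (qShifted (q / (y * q ^ k)) q i * q ^ (k * i)) *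
        (qShifted y q k * qShifted (q / y) q k) =
        qShifted (y / q ^ i) q k * qShifted (q / y * q ^ i) q k := by
      rw [div_mul_eq_mul_div, div_eq_iff (mul_ne_zero d1 hki)]
      apply mul_right_cancel₀ d2
      linear_combination (-(qShifted (q / y) q k * qShifted (q / y * q ^ k) q i)) * s1 -
        (qShifted (y / q ^ i) q k * (qShifted (q / (y * q ^ k)) q i * q ^ (k * i))) * s2
    rw [← s3]
    ring
  have hsum : ∑ i ∈ range (l + 1), shiftCoeff y w q l i *
        (qShifted (y / q ^ i) q k * qShifted (q / y * q ^ i) q k / qShifted w q k) =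
      (∑ i ∈ range (l + 1), vwpTerm (q / y ^ 2) (q / y * q ^ k) (w / y) q l i) *
        (qShifted y q k * qShifted (q / y) q k) / qShifted w q k := by
    rw [sum_mul, sum_div]
    refine sum_congr rfl fun i hi => ?_
    rw [hterm i hi]; ring
  rw [hsum, key]
  have t1 := qShifted_div_pow hy hq0 l k
  have t2 := qShifted_div_pow hw hq0 l k
  have d1 : qShifted (q / (y * q ^ k)) q l ≠ 0 := qShifted_ne_zero fun r _ => nB r
  have d2 : qShifted (q / w) q l ≠ 0 := qShifted_ne_zero fun r _ => nW r
  have d3 : qShifted (q ^ 2 / (y * w)) q l ≠ 0 := qShifted_ne_zero fun r _ => nC r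
  have d4 : qShifted (q ^ 2 / y ^ 2) q l ≠ 0 := qShifted_ne_zero fun r _ => nA' r
  have d5 : qShifted w q k ≠ 0 := qShifted_ne_zero fun r _ => nw r
  have d6 : qShifted (w / q ^ l) q k ≠ 0 := qShifted_ne_zero fun r _ => nW' r
  have d7 := hp (k * l)
  generalize qShifted (q / (y * q ^ k)) q l = x1 at *
  generalize qShifted (q / w) q l = x2 at *
  generalize qShifted (q ^ 2 / (y * w)) q l = x3 at *
  generalize qShifted (q ^ 2 / y ^ 2) q l = x4 at *
  generalize qShifted w q k = x5 at *
  generalize qShifted (w / q ^ l) q k = x6 at *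
  generalize qShifted (q / y) q l = x7 at *
  generalize qShifted (q / y) q k = x8 at *
  generalize qShifted (q / (w * q ^ k)) q l = x9 at *
  generalize qShifted y q k = x10 at *
  generalize qShifted (y / q ^ l) q k = x11 at *
  generalize q ^ (k * l) = x12 at *
  field_simp
  apply mul_right_cancel₀ d7
  linear_combination (x8 * x2 * x5) * t1 - (x7 * x10 * x8) * t2

/-- The two prefactors produced by two applications of Sears' transformation combine to the second
prefactor of the identity. -/
theorem sears_prefactor {a c q : ℂ} (h : IsGeneric a c q) (l m n : ℕ) :
    (-(q ^ (m + n))⁻¹) ^ n *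
        (qShifted (c / -(q ^ (m + n))⁻¹) q n *
          qShifted (q ^ (1 + l) / (q ^ (m + 2 * n) * c) / -(q ^ (m + n))⁻¹) q n) /
        (qShifted c q n * qShifted (q ^ (1 + l) / (q ^ (m + 2 * n) * c)) q n) *
      ((-(q ^ (m + n))⁻¹) ^ n *
        (qShifted (-q / -(q ^ (m + n))⁻¹) q n *
          qShifted (-q / (q ^ (m + 2 * n) * c) / -(q ^ (m + n))⁻¹) q n) /
        (qShifted (-q) q n * qShifted (-q / (q ^ (m + 2 * n) * c)) q n)) =
      qShifted (q ^ (1 + m + n)) q n * qShifted (-c / q ^ l) q n /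
        (qShifted (q ^ (m + n) * c / q ^ l) q n * qShifted (-q) q n) := by
  have hq0 := h.q_ne
  have hc := h.c_ne
  have hp : ∀ k, q ^ k ≠ 0 := fun k => pow_ne_zero k hq0
  have hl := hp l
  have hN := hp (m + n)
  have hn := hp n
  have e0 : q ^ (m + 2 * n) = q ^ (m + n) * q ^ n := by rw [← pow_add]; congr 1; ring
  have r1 := qShifted_reverse_full (x := -c / q ^ l) (div_ne_zero (neg_ne_zero.2 hc) hl) hq0 n
  have r2 := qShifted_reverse_full hc hq0 n
  have r3 := qShifted_reverse_full (x := q ^ (m + n) * c / q ^ l)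
    (div_ne_zero (mul_ne_zero hN hc) hl) hq0 n
  have r4 := qShifted_reverse_full (x := -q ^ (m + n) * c)
    (mul_ne_zero (neg_ne_zero.2 hN) hc) hq0 n
  have e1 : q ^ (1 + l) / (q ^ (m + 2 * n) * c) / -(q ^ (m + n))⁻¹ = q / (q ^ n * (-c / q ^ l)) := by
    rw [e0, pow_add]; field_simp
  have e2 : -q / (q ^ (m + 2 * n) * c) / -(q ^ (m + n))⁻¹ = q / (q ^ n * c) := by
    rw [e0]; field_simp
  have e3 : q ^ (1 + l) / (q ^ (m + 2 * n) * c) = q / (q ^ n * (q ^ (m + n) * c / q ^ l)) := by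
    rw [e0, pow_add]; field_simp
  have e4 : -q / (q ^ (m + 2 * n) * c) = q / (q ^ n * (-q ^ (m + n) * c)) := by
    rw [e0]; field_simp
  have e5 : c / -(q ^ (m + n))⁻¹ = -q ^ (m + n) * c := by field_simp
  have e6 : -q / -(q ^ (m + n))⁻¹ = q ^ (1 + m + n) := by
    rw [add_assoc, pow_add q 1]; field_simp
  have hmon : (-(q ^ (m + n))⁻¹) ^ n * (-(q ^ (m + n))⁻¹) ^ n * (q ^ (m + n) * c / q ^ l) ^ n *
      (-q ^ (m + n) * c) ^ n = (-c / q ^ l) ^ n * c ^ n := by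
    rw [← mul_pow, ← mul_pow, ← mul_pow, ← mul_pow]; congr 1; field_simp
  have d1 : qShifted (q / (q ^ n * (q ^ (m + n) * c / q ^ l))) q n ≠ 0 := by
    rw [← e3]
    refine qShifted_ne_zero fun r _ e => ?_
    have := hp (m + 2 * n)
    field_simp at e
    exact h.c_mul_pow_ne (m + 2 * n) (1 + l + r) (by rw [pow_add]; linear_combination -e)
  have d2 : qShifted (q / (q ^ n * (-q ^ (m + n) * c))) q n ≠ 0 := by
    rw [← e4]
    refine qShifted_ne_zero fun r _ e => ?_
    have := hp (m + 2 * n)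
    field_simp at e
    exact h.c_mul_pow_ne_neg (m + 2 * n) (1 + r) (by rw [pow_add]; linear_combination -e)
  have d3 : qShifted c q n ≠ 0 := qShifted_ne_zero fun r _ e =>
    h.c_mul_pow_ne r 0 (by simpa using e)
  rw [e1, e2, e5, e6, e3, e4]
  have d4 := revFactor_ne_zero hq0 n n
  have d5 : (-c / q ^ l) ^ n ≠ 0 := pow_ne_zero _ (div_ne_zero (neg_ne_zero.2 hc) hl)
  have d6 : c ^ n ≠ 0 := pow_ne_zero _ hc
  have d7 : (q ^ (m + n) * c / q ^ l) ^ n ≠ 0 :=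
    pow_ne_zero _ (div_ne_zero (mul_ne_zero hN hc) hl)
  have d8 : (-q ^ (m + n) * c) ^ n ≠ 0 := pow_ne_zero _ (mul_ne_zero (neg_ne_zero.2 hN) hc)
  have d9 : qShifted (-q) q n ≠ 0 := qShifted_ne_zero fun r _ e =>
    h.pow_ne_neg_pow (r + 1) 0 (by rw [pow_succ]; linear_combination -e)
  rw [r4, r1, r3]
  rw [r2] at d3 ⊢
  have d10 := left_ne_zero_of_mul d3
  generalize (-(q ^ (m + n))⁻¹) ^ n = w0 at *
  generalize (-c / q ^ l) ^ n = w1 at *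
  generalize c ^ n = w2 at *
  generalize (q ^ (m + n) * c / q ^ l) ^ n = w3 at *
  generalize (-q ^ (m + n) * c) ^ n = w4 at *
  generalize revFactor q n n = w5 at *
  generalize qShifted (q / (q ^ n * (q ^ (m + n) * c / q ^ l))) q n = w6 at *
  generalize qShifted (q / (q ^ n * (-q ^ (m + n) * c))) q n = w7 at *
  generalize qShifted (q / (q ^ n * c)) q n = w8 at *
  generalize qShifted (q / (q ^ n * (-c / q ^ l))) q n = w9 at *
  generalize qShifted (-q) q n = w10 at *
  generalize qShifted (q ^ (1 + m + n)) q n = w11 at *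
  field_simp
  linear_combination (w11 * w9) * hmon

/-- The left-hand side of the identity as a finite sum, without negative exponents. -/
noncomputable def phiSum (a c q : ℂ) (l m n : ℕ) : ℂ :=
  ∑ k ∈ range (n + 1),
    qShifted (q ^ n)⁻¹ q k * qShifted (-(q ^ (m + n))⁻¹) q k *
      (qShifted a q k * qShifted (q ^ (1 + l) / a) q k) /
      (qShifted q q k * qShifted (-q) q k *
        (qShifted c q k * qShifted (q ^ (1 + l) / (q ^ (m + 2 * n) * c)) q k)) * q ^ k

/-- The right-hand side of the identity, in terms of the coefficients of the two expansions. -/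
noncomputable def expansionSum (a c q : ℂ) (l m n : ℕ) : ℂ :=
  qShifted (q / -a) q l * qShifted (q ^ 2 / (-a * -c)) q l /
      (qShifted (q ^ 2 / (-a) ^ 2) q l * qShifted (q / -c) q l) *
    (qShifted (q ^ (1 + m + n)) q n * qShifted (-c / q ^ l) q n /
      (qShifted (q ^ (m + n) * c / q ^ l) q n * qShifted (-q) q n)) *
    ∑ i ∈ range (l + 1), shiftCoeff (-a) (-c) q l i *
      ∑ j ∈ range (m + 1), watsonCoeff (q ^ i * c / a) (a * c / q ^ (i + 1)) q m n j *
        (qShifted (q * (q ^ i * c / a * q ^ j)) (q ^ 2) (m + n - j) *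
          qShifted (q * (a * c / q ^ (i + 1) * q ^ j)) (q ^ 2) (m + n - j) /
        (qShifted q (q ^ 2) (m + n - j) *
          qShifted (q * (q ^ i * c / a * q ^ j) * (a * c / q ^ (i + 1) * q ^ j)) (q ^ 2)
            (m + n - j)))

/-- For generic parameters: Sears' transformation brings `l` into the position required by
`qShifted_shift_expansion`, and a second one brings the terms of that expansion into the form
required by `sum_eq_sum_watsonCoeff`. -/
theorem phiSum_eq_expansionSum_of_isGeneric {a c q : ℂ} (h : IsGeneric a c q) (l m n : ℕ) :
    phiSum a c q l m n = expansionSum a c q l m n := by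
  rw [phiSum, expansionSum]
  have hq0 := h.q_ne
  have ha := h.a_ne
  have hc := h.c_ne
  have hp : ∀ k, q ^ k ≠ 0 := fun k => pow_ne_zero k hq0
  have hl := hp l
  have hN := hp (m + n)
  have hn := hp n
  have hM := hp (m + 2 * n)
  have e0 : q ^ (m + 2 * n) = q ^ (m + n) * q ^ n := by rw [← pow_add]; congr 1; ring
  have c1 : ∀ k : ℕ, -q * q ^ k ≠ 1 := fun k e =>
    h.pow_ne_neg_pow (k + 1) 0 (by rw [pow_succ]; linear_combination -e)
  have c2 : ∀ k : ℕ, c * q ^ k ≠ 1 := fun k e => h.c_mul_pow_ne k 0 (by simpa using e)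
  have c2' : ∀ k : ℕ, -c * q ^ k ≠ 1 := fun k e =>
    h.c_mul_pow_ne_neg k 0 (by linear_combination -e)
  have c3 : ∀ k : ℕ, q ^ (1 + l) / (q ^ (m + 2 * n) * c) * q ^ k ≠ 1 := fun k e => by
    field_simp at e
    exact h.c_mul_pow_ne (m + 2 * n) (1 + l + k) (by rw [pow_add]; linear_combination -e)
  have c3' : ∀ k : ℕ, -q / (q ^ (m + 2 * n) * c) * q ^ k ≠ 1 := fun k e => by
    field_simp at e
    exact h.c_mul_pow_ne_neg (m + 2 * n) (1 + k) (by rw [pow_add]; linear_combination -e)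
  have c4 : ∀ k : ℕ, q ^ (k + 1) ≠ q ^ n * -(q ^ (m + n))⁻¹ := fun k e => by
    field_simp at e
    exact h.pow_ne_neg_pow (m + n + (k + 1)) n (by rw [pow_add q (m + n)]; linear_combination e)
  have c5 : ∀ k : ℕ, -c / q ^ l * q ^ k ≠ 1 := fun k e => by
    field_simp at e
    exact h.c_mul_pow_ne_neg k l (by linear_combination -e)
  have f1 : -(q ^ (m + n))⁻¹ * q / (q ^ n * c) = -q / (q ^ (m + 2 * n) * c) := by
    rw [e0]; field_simp
  have f2 : -(q ^ (m + n))⁻¹ * q / (q ^ n * (q ^ (1 + l) / (q ^ (m + 2 * n) * c))) =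
      -c / q ^ l := by
    rw [e0, pow_add q 1 l]; field_simp
  have s1 := sears (α := -(q ^ (m + n))⁻¹) (b := a) (c := q ^ (1 + l) / a) (d := -q) (e := c)
    (f := q ^ (1 + l) / (q ^ (m + 2 * n) * c)) n hq0 (neg_ne_zero.2 (inv_ne_zero hN)) ha
    (div_ne_zero (hp _) ha) (neg_ne_zero.2 hq0) hc (div_ne_zero (hp _) (mul_ne_zero hM hc)) h.hq
    c1 c2 c3 c4 (by rw [f1]; exact fun k _ => c3' k) (by rw [f2]; exact fun k _ => c5 k)
    (by rw [e0]; field_simp)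
  rw [f1, f2] at s1
  have f3 : -q / a = q / -a := by rw [div_neg, neg_div]
  have f4 : -q / (q ^ (1 + l) / a) = -a / q ^ l := by rw [pow_add q 1 l, pow_one]; field_simp
  rw [f3, f4] at s1
  have g1 : -(q ^ (m + n))⁻¹ * q / (q ^ n * -q) = (q ^ (m + 2 * n))⁻¹ := by
    rw [e0]; field_simp
  have g2 : -(q ^ (m + n))⁻¹ * q / (q ^ n * (-q / (q ^ (m + 2 * n) * c))) = c := by
    rw [e0]; field_simp
  have s2 := fun i => sears (α := -(q ^ (m + n))⁻¹) (b := -a / q ^ i)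
    (c := q / -a * q ^ i) (d := -c) (e := -q) (f := -q / (q ^ (m + 2 * n) * c)) n hq0
    (neg_ne_zero.2 (inv_ne_zero hN)) (div_ne_zero (neg_ne_zero.2 ha) (hp i))
    (mul_ne_zero (div_ne_zero hq0 (neg_ne_zero.2 ha)) (hp i)) (neg_ne_zero.2 hc)
    (neg_ne_zero.2 hq0) (div_ne_zero (neg_ne_zero.2 hq0) (mul_ne_zero hM hc)) h.hq
    c2' c1 c3' c4
    (by rw [g1]; exact fun k hk => inv_pow_mul_pow_ne_one hq0 h.hq (by omega))
    (by rw [g2]; exact fun k _ => c2 k) (by have := hp i; rw [e0]; field_simp)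
  have g3 : ∀ i, -c / (-a / q ^ i) = q ^ i * c / a := fun i => by
    have := hp i; field_simp
  have g4 : ∀ i, -c / (q / -a * q ^ i) = a * c / q ^ (i + 1) := fun i => by
    have := hp i; rw [pow_succ]; field_simp
  have guv : ∀ i, q * (q ^ i * c / a) * (a * c / q ^ (i + 1)) = c ^ 2 := fun i => by
    have := hp i; rw [pow_succ]; field_simp
  simp only [g1, g2, g3, g4] at s2
  have w := fun i => sum_eq_sum_watsonCoeff (u := q ^ i * c / a) (v := a * c / q ^ (i + 1)) hq0
    h.hq (fun k => by
      rw [guv, ← pow_mul]; exact fun e => h.hc (2 * k) 0 (by simpa using e)) m n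
  simp only [← w, guv, ← qShifted_mul_qShifted_neg]
  rw [s1]
  have hsum : ∀ k ∈ range (n + 1),
      qShifted (q ^ n)⁻¹ q k * qShifted (-(q ^ (m + n))⁻¹) q k *
          (qShifted (q / -a) q k * qShifted (-a / q ^ l) q k) /
        (qShifted q q k * qShifted (-q) q k * (qShifted (-q / (q ^ (m + 2 * n) * c)) q k *
          qShifted (-c / q ^ l) q k)) * q ^ k =
      qShifted (q / -a) q l * qShifted (q ^ 2 / (-a * -c)) q l /
        (qShifted (q ^ 2 / (-a) ^ 2) q l * qShifted (q / -c) q l) *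
      ∑ i ∈ range (l + 1), shiftCoeff (-a) (-c) q l i *
        (qShifted (q ^ n)⁻¹ q k * qShifted (-(q ^ (m + n))⁻¹) q k *
          (qShifted (-a / q ^ i) q k * qShifted (q / -a * q ^ i) q k) /
        (qShifted q q k * qShifted (-c) q k * (qShifted (-q) q k *
          qShifted (-q / (q ^ (m + 2 * n) * c)) q k)) * q ^ k) := by
    intro k _
    have e := qShifted_shift_expansion h.neg l k
    have e2 : ∑ i ∈ range (l + 1), shiftCoeff (-a) (-c) q l i *
        (qShifted (q ^ n)⁻¹ q k * qShifted (-(q ^ (m + n))⁻¹) q k *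
          (qShifted (-a / q ^ i) q k * qShifted (q / -a * q ^ i) q k) /
        (qShifted q q k * qShifted (-c) q k * (qShifted (-q) q k *
          qShifted (-q / (q ^ (m + 2 * n) * c)) q k)) * q ^ k) =
        (∑ i ∈ range (l + 1), shiftCoeff (-a) (-c) q l i *
          (qShifted (-a / q ^ i) q k * qShifted (q / -a * q ^ i) q k / qShifted (-c) q k)) *
        (qShifted (q ^ n)⁻¹ q k * qShifted (-(q ^ (m + n))⁻¹) q k /
        (qShifted q q k * (qShifted (-q) q k *
          qShifted (-q / (q ^ (m + 2 * n) * c)) q k)) * q ^ k) := by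
      rw [sum_mul]
      refine sum_congr rfl fun i _ => ?_
      ring
    rw [e2, ← mul_assoc _ (Finset.sum _ _), ← e]
    ring
  rw [sum_congr rfl hsum, ← mul_sum, sum_comm]
  simp only [← mul_sum, s2]
  rw [← sears_prefactor h]
  simp only [mul_sum]
  refine sum_congr rfl fun i _ => sum_congr rfl fun k _ => ?_
  ring

/-! ### Extension to all admissible parameters by continuity -/

/-- The parameters for which no denominator in the identity vanishes. -/
structure IsAdmissible (a c q : ℂ) (l m n : ℕ) : Prop where
  q_ne : q ≠ 0
  a_ne : a ≠ 0
  c_ne : c ≠ 0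
  hq : ∀ k : ℕ, 1 ≤ k → k ≤ max l (2 * m + 2 * n) → q ^ k ≠ 1
  ha : ∀ k : ℕ, 1 ≤ k → k ≤ 2 * l + 1 → a ^ 2 ≠ q ^ k
  hac : ∀ k : ℕ, 2 ≤ k → k ≤ l + 1 → a * c ≠ q ^ k
  hc1 : ∀ k : ℕ, 1 ≤ k → k ≤ l → c ≠ -q ^ k
  hc2 : ∀ k : ℕ, k < m + n → c ^ 2 * q ^ (2 * k) ≠ 1
  hc3 : ∀ k : ℕ, k < n → c * q ^ (m + n + k) ≠ q ^ l

namespace IsAdmissible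

variable {a c q : ℂ} {l m n : ℕ}

theorem qShifted_q_ne_zero (h : IsAdmissible a c q l m n) {k : ℕ}
    (hk : k ≤ max l (2 * m + 2 * n)) : qShifted q q k ≠ 0 :=
  qShifted_ne_zero fun r hr => by rw [← pow_succ']; exact h.hq _ (by omega) (by omega)

theorem qShifted_neg_q_ne_zero (h : IsAdmissible a c q l m n) {k : ℕ} (hk : k ≤ n) :
    qShifted (-q) q k ≠ 0 :=
  qShifted_ne_zero fun r hr e => h.hq (2 * (r + 1)) (by omega) (by omega) (by
    rw [pow_mul', pow_succ' q r]; linear_combination (1 - q * q ^ r) * e)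

theorem qShifted_c_ne_zero (h : IsAdmissible a c q l m n) {k : ℕ} (hk : k ≤ m + n) :
    qShifted c q k ≠ 0 :=
  qShifted_ne_zero fun r hr e => h.hc2 r (by omega) (by
    rw [pow_mul', ← mul_pow, e, one_pow])

theorem qShifted_q_div_c_large_ne_zero (h : IsAdmissible a c q l m n) {k : ℕ} (hk : k ≤ n) :
    qShifted (q ^ (1 + l) / (q ^ (m + 2 * n) * c)) q k ≠ 0 :=
  qShifted_ne_zero fun r hr e => h.hc3 (n - 1 - r) (by omega) (by
    have h1 := h.q_ne
    have h2 := h.c_ne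
    have h3 := pow_ne_zero (r + 1) h1
    have h4 : q ^ (m + 2 * n) = q ^ (m + n + (n - 1 - r)) * q ^ (r + 1) := by
      rw [← pow_add]; congr 1; omega
    rw [div_mul_eq_mul_div, div_eq_one_iff_eq (mul_ne_zero (pow_ne_zero _ h1) h2), h4] at e
    apply mul_right_cancel₀ h3
    rw [pow_add q 1 l] at e
    rw [pow_add q r 1] at e ⊢
    linear_combination -e)

theorem qShifted_a_ne_zero (h : IsAdmissible a c q l m n) :
    qShifted (q ^ 2 / (-a) ^ 2) q l ≠ 0 :=
  qShifted_ne_zero fun r hr e => h.ha (r + 2) (by omega) (by omega) (by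
    have := h.a_ne
    rw [neg_sq] at e
    field_simp at e
    rw [pow_add]; linear_combination -e)

theorem qShifted_q_div_c_ne_zero (h : IsAdmissible a c q l m n) :
    qShifted (q / -c) q l ≠ 0 :=
  qShifted_ne_zero fun r hr e => h.hc1 (r + 1) (by omega) (by omega) (by
    have := neg_ne_zero.2 h.c_ne
    rw [div_mul_eq_mul_div, div_eq_one_iff_eq this] at e
    rw [pow_succ]; linear_combination e)

theorem qShifted_qc_ne_zero (h : IsAdmissible a c q l m n) :
    qShifted (q ^ (m + n) * c / q ^ l) q n ≠ 0 :=
  qShifted_ne_zero fun r hr e => h.hc3 r hr (by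
    rw [div_mul_eq_mul_div, div_eq_one_iff_eq (pow_ne_zero _ h.q_ne)] at e
    rw [pow_add q (m + n) r]; linear_combination e)

theorem qShifted_ac_ne_zero (h : IsAdmissible a c q l m n) {i : ℕ} (hi : i ≤ l) :
    qShifted (q ^ 2 / (-a * -c)) q i ≠ 0 :=
  qShifted_ne_zero fun r hr e => h.hac (r + 2) (by omega) (by omega) (by
    have := h.a_ne
    have := h.c_ne
    rw [neg_mul_neg] at e
    field_simp at e
    rw [pow_add]; linear_combination -e)

theorem qShifted_a_shift_ne_zero (h : IsAdmissible a c q l m n) {i : ℕ} (hi : i ≤ l) :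
    qShifted (q / (-a) ^ 2 * q ^ (l + 1)) q i ≠ 0 :=
  qShifted_ne_zero fun r hr e => h.ha (l + 2 + r) (by omega) (by omega) (by
    have := h.a_ne
    rw [neg_sq] at e
    field_simp at e
    rw [pow_add, pow_add q l 2]; rw [pow_add q l 1] at e; linear_combination -e)

theorem one_sub_ne_zero (h : IsAdmissible a c q l m n) : 1 - q / (-a) ^ 2 ≠ 0 := fun e =>
  h.ha 1 le_rfl (by omega) (by
    have := h.a_ne
    rw [neg_sq] at e
    field_simp at e
    linear_combination e)

theorem mul_params (h : IsAdmissible a c q l m n) (i j : ℕ) :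
    q * (q ^ i * c / a * q ^ j) * (a * c / q ^ (i + 1) * q ^ j) = c ^ 2 * (q ^ 2) ^ j := by
  have := h.a_ne
  have := h.q_ne
  have := pow_ne_zero i h.q_ne
  rw [pow_succ, ← pow_mul, pow_mul']
  field_simp

theorem qShifted_sq_ne_zero (h : IsAdmissible a c q l m n) {k : ℕ} (i j : ℕ) (hk : j + k ≤ m + n) :
    qShifted (q * (q ^ i * c / a * q ^ j) * (a * c / q ^ (i + 1) * q ^ j)) (q ^ 2) k ≠ 0 := by
  rw [h.mul_params]
  refine qShifted_ne_zero fun r hr => ?_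
  rw [mul_assoc, ← pow_add, ← pow_mul]
  exact h.hc2 _ (by omega)

theorem qShifted_q_sq_ne_zero (h : IsAdmissible a c q l m n) {k : ℕ} (hk : k ≤ m + n) :
    qShifted q (q ^ 2) k ≠ 0 :=
  qShifted_ne_zero fun r hr => by
    rw [← pow_mul, ← pow_succ']; exact h.hq _ (by omega) (by omega)

theorem pow_div_pow_ne_one (h : IsAdmissible a c q l m n) {s t : ℕ} (hst : s < t)
    (ht : t ≤ s + (2 * m + 2 * n)) : q ^ s / q ^ t ≠ 1 := fun e => by
  obtain ⟨r, rfl⟩ := Nat.exists_eq_add_of_lt hst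
  rw [div_eq_one_iff_eq (pow_ne_zero _ h.q_ne), add_assoc, pow_add] at e
  exact h.hq (r + 1) (by omega) (by omega)
    (mul_left_cancel₀ (pow_ne_zero s h.q_ne) (by rw [mul_one, ← e]))

theorem qShifted_inv_pow_ne_zero (h : IsAdmissible a c q l m n) {j : ℕ} (hj : j ≤ m) :
    qShifted (q ^ (m + 2 * n))⁻¹ q j ≠ 0 :=
  qShifted_ne_zero fun r hr => by
    rw [mul_comm, ← div_eq_mul_inv]; exact h.pow_div_pow_ne_one (by omega) (by omega)

theorem qShifted_vwp_ne_zero (h : IsAdmissible a c q l m n) {j : ℕ} (hj : j ≤ m) :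
    qShifted (q ^ j / q ^ (2 * (m + n) + 1)) q j ≠ 0 :=
  qShifted_ne_zero fun r hr => by
    rw [div_mul_eq_mul_div, ← pow_add]; exact h.pow_div_pow_ne_one (by omega) (by omega)

end IsAdmissible

@[fun_prop]
theorem ContinuousAt.qShifted {f g : ℂ → ℂ} {t : ℂ} (hf : ContinuousAt f t)
    (hg : ContinuousAt g t) (k : ℕ) : ContinuousAt (fun x => qShifted (f x) (g x) k) t := by
  unfold _root_.qShifted
  fun_prop

section Continuity

variable {A C Q : ℂ → ℂ} {t : ℂ} {l m n : ℕ}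

theorem continuousAt_phiSum (hA : ContinuousAt A t) (hC : ContinuousAt C t)
    (hQ : ContinuousAt Q t) (h : IsAdmissible (A t) (C t) (Q t) l m n) :
    ContinuousAt (fun x => phiSum (A x) (C x) (Q x) l m n) t := by
  unfold phiSum
  refine tendsto_finsetSum _ fun k hk => ?_
  have hk : k ≤ n := by simpa [Nat.lt_succ_iff] using hk
  have h1 := h.q_ne
  have h2 := h.a_ne
  have h3 := h.c_ne
  have h4 := h.qShifted_q_ne_zero (k := k) (by omega)
  have h5 := h.qShifted_neg_q_ne_zero hk
  have h6 := h.qShifted_c_ne_zero (k := k) (by omega)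
  have h7 := h.qShifted_q_div_c_large_ne_zero hk
  change ContinuousAt _ t
  fun_prop (disch := positivity)

theorem continuousAt_shiftCoeff (hA : ContinuousAt A t) (hC : ContinuousAt C t)
    (hQ : ContinuousAt Q t) (h : IsAdmissible (A t) (C t) (Q t) l m n) {i : ℕ} (hi : i ≤ l) :
    ContinuousAt (fun x => shiftCoeff (-A x) (-C x) (Q x) l i) t := by
  unfold shiftCoeff
  have h1 := h.q_ne
  have h2 := neg_ne_zero.2 h.a_ne
  have h3 := neg_ne_zero.2 h.c_ne
  have h4 := h.qShifted_q_ne_zero (k := i) (by omega)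
  have h5 := h.one_sub_ne_zero
  have h6 := h.qShifted_ac_ne_zero hi
  have h7 := h.qShifted_a_shift_ne_zero hi
  fun_prop (disch := first | assumption | positivity)

theorem continuousAt_watsonCoeff (hA : ContinuousAt A t) (hC : ContinuousAt C t)
    (hQ : ContinuousAt Q t) (h : IsAdmissible (A t) (C t) (Q t) l m n) (i : ℕ) {j : ℕ}
    (hj : j ≤ m) :
    ContinuousAt (fun x => watsonCoeff (Q x ^ i * C x / A x) (A x * C x / Q x ^ (i + 1)) (Q x)
      m n j) t := by
  unfold watsonCoeff
  have h1 := h.q_ne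
  have h2 := h.a_ne
  have h3 := h.c_ne
  have h4 := h.qShifted_q_ne_zero (k := j) (by omega)
  have h5 := h.qShifted_sq_ne_zero (k := j) i 0 (by omega)
  rw [pow_zero, mul_one, mul_one] at h5
  have h6 := h.qShifted_inv_pow_ne_zero hj
  have h7 := h.qShifted_vwp_ne_zero hj
  fun_prop (disch := first | assumption | positivity)

theorem continuousAt_expansionSum (hA : ContinuousAt A t) (hC : ContinuousAt C t)
    (hQ : ContinuousAt Q t) (h : IsAdmissible (A t) (C t) (Q t) l m n) :
    ContinuousAt (fun x => expansionSum (A x) (C x) (Q x) l m n) t := by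
  unfold expansionSum
  have h1 := h.q_ne
  have h2 := h.a_ne
  have h3 := h.c_ne
  have h2' := neg_ne_zero.2 h.a_ne
  have h3' := neg_ne_zero.2 h.c_ne
  refine ContinuousAt.mul (ContinuousAt.mul ?_ ?_) ?_
  · have h4 := h.qShifted_a_ne_zero
    have h5 := h.qShifted_q_div_c_ne_zero
    fun_prop (disch := first | assumption | positivity)
  · have h4 := h.qShifted_qc_ne_zero
    have h5 := h.qShifted_neg_q_ne_zero (k := n) le_rfl
    fun_prop (disch := first | assumption | positivity)
  · refine tendsto_finsetSum _ fun i hi => ?_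
    have hi : i ≤ l := by simpa [Nat.lt_succ_iff] using hi
    refine (continuousAt_shiftCoeff hA hC hQ h hi).mul ?_
    refine tendsto_finsetSum _ fun j hj => ?_
    have hj : j ≤ m := by simpa [Nat.lt_succ_iff] using hj
    refine (continuousAt_watsonCoeff hA hC hQ h i hj).mul ?_
    have h4 := h.qShifted_q_sq_ne_zero (k := m + n - j) (by omega)
    have h5 := h.qShifted_sq_ne_zero (k := m + n - j) i j (by omega)
    change ContinuousAt _ t
    fun_prop (disch := first | assumption | positivity)

end Continuity

theorem countable_setOf_exp_mul_eq {μ : ℂ} (hμ : μ ≠ 0) (w : ℂ) :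
    {x : ℂ | Complex.exp (μ * x) = w}.Countable := by
  have h : {z : ℂ | Complex.exp z = w}.Countable := by
    by_cases hw : ∃ z, Complex.exp z = w
    · obtain ⟨z, rfl⟩ := hw
      refine (Set.countable_range fun k : ℤ => z + k * (2 * Real.pi * Complex.I)).mono ?_
      intro y hy
      obtain ⟨k, hk⟩ := Complex.exp_eq_exp_iff_exists_int.1 hy
      exact ⟨k, hk.symm⟩
    · push Not at hw
      refine Set.countable_empty.mono fun z hz => hw z hz
  exact h.preimage_of_injOn (f := fun x => μ * x) (mul_right_injective₀ hμ).injOn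

/-- A relation of the kind excluded by `IsGeneric` holds for countably many points of the path
only: the exponent `r * I + s - t` has imaginary part `r ≠ 0`. -/
theorem countable_setOf_pow_eq {b q : ℂ} (hb : b ≠ 0) (hq : q ≠ 0) {r : ℕ} (hr : r ≠ 0)
    (s t : ℕ) :
    {x : ℂ | (b * Complex.exp (r * Complex.I * x)) * (q * Complex.exp x) ^ s =
      (q * Complex.exp x) ^ t}.Countable := by
  have hμ : (r * Complex.I + s - t : ℂ) ≠ 0 := fun e => hr (by
    have := congrArg Complex.im e
    simpa using this)
  refine (countable_setOf_exp_mul_eq hμ (q ^ t / (b * q ^ s))).mono fun x hx => ?_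
  simp only [Set.mem_ofPred_eq, mul_pow, ← Complex.exp_nat_mul] at hx ⊢
  rw [eq_div_iff (mul_ne_zero hb (pow_ne_zero _ hq))]
  have e : (r * Complex.I + s - t : ℂ) * x = r * Complex.I * x + s * x - t * x := by ring
  rw [e, Complex.exp_sub, Complex.exp_add, div_mul_eq_mul_div, div_eq_iff (Complex.exp_ne_zero _)]
  linear_combination hx

/-- Every triple of nonzero parameters is a limit of generic ones. The exponents `I`, `2 * I` and
`1` keep the relations in `IsGeneric` independent along the path. -/
theorem frequently_isGeneric {a c q : ℂ} (ha : a ≠ 0) (hc : c ≠ 0) (hq : q ≠ 0) :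
    ∃ᶠ x : ℂ in nhds 0, IsGeneric (a * Complex.exp (Complex.I * x))
      (c * Complex.exp (2 * Complex.I * x)) (q * Complex.exp x) := by
  have key : Set.Countable ((⋃ k : ℕ, {x : ℂ | (q * Complex.exp x) ^ (k + 1) = 1}) ∪
      (⋃ s : ℕ, ⋃ t : ℕ, {x : ℂ | (a ^ 2 * Complex.exp ((2 : ℕ) * Complex.I * x)) *
        (q * Complex.exp x) ^ s = (q * Complex.exp x) ^ t}) ∪
      (⋃ s : ℕ, ⋃ t : ℕ, {x : ℂ | (c ^ 2 * Complex.exp ((4 : ℕ) * Complex.I * x)) *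
        (q * Complex.exp x) ^ s = (q * Complex.exp x) ^ t}) ∪
      (⋃ s : ℕ, ⋃ t : ℕ, {x : ℂ | ((a * c) ^ 2 * Complex.exp ((6 : ℕ) * Complex.I * x)) *
        (q * Complex.exp x) ^ s = (q * Complex.exp x) ^ t})) := by
    refine ((Set.Countable.union (Set.countable_iUnion fun k => ?_) ?_).union ?_).union ?_
    · refine (countable_setOf_exp_mul_eq (Nat.cast_ne_zero.2 k.succ_ne_zero)
        (q ^ (k + 1))⁻¹).mono fun x hx => ?_
      simp only [Set.mem_ofPred_eq, mul_pow, ← Complex.exp_nat_mul] at hx ⊢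
      exact eq_inv_of_mul_eq_one_right hx
    all_goals
      refine Set.countable_iUnion fun s => Set.countable_iUnion fun t =>
        countable_setOf_pow_eq ?_ hq (by norm_num) s t
      positivity
  refine (mem_closure_iff_frequently.1 (key.dense_compl ℝ 0)).mono fun x hx => ?_
  simp only [Set.mem_compl_iff, Set.mem_union, Set.mem_iUnion, Set.mem_ofPred_eq, not_or,
    not_exists] at hx
  obtain ⟨⟨⟨h1, h2⟩, h3⟩, h4⟩ := hx
  have e2 : (a * Complex.exp (Complex.I * x)) ^ 2 =
      a ^ 2 * Complex.exp ((2 : ℕ) * Complex.I * x) := by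
    rw [mul_pow, ← Complex.exp_nat_mul, mul_assoc]
  have e4 : (c * Complex.exp (2 * Complex.I * x)) ^ 2 =
      c ^ 2 * Complex.exp ((4 : ℕ) * Complex.I * x) := by
    rw [mul_pow, ← Complex.exp_nat_mul]; congr 2; push_cast; ring
  have e6 : (a * Complex.exp (Complex.I * x) * (c * Complex.exp (2 * Complex.I * x))) ^ 2 =
      (a * c) ^ 2 * Complex.exp ((6 : ℕ) * Complex.I * x) := by
    rw [mul_pow, e2, e4, mul_mul_mul_comm, ← Complex.exp_add, mul_pow]
    congr 2; push_cast; ring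
  exact
    { q_ne := mul_ne_zero hq (Complex.exp_ne_zero _)
      a_ne := mul_ne_zero ha (Complex.exp_ne_zero _)
      c_ne := mul_ne_zero hc (Complex.exp_ne_zero _)
      hq := h1
      ha := fun s t => by rw [e2]; exact h2 s t
      hc := fun s t => by rw [e4]; exact h3 s t
      hac := fun s t => by rw [e6]; exact h4 s t }

/-- The identity for all admissible parameters, as the limit of the generic case. -/
theorem phiSum_eq_expansionSum {a c q : ℂ} {l m n : ℕ} (h : IsAdmissible a c q l m n) :
    phiSum a c q l m n = expansionSum a c q l m n := by
  have hA : ContinuousAt (fun x => a * Complex.exp (Complex.I * x)) 0 := by fun_prop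
  have hC : ContinuousAt (fun x => c * Complex.exp (2 * Complex.I * x)) 0 := by fun_prop
  have hQ : ContinuousAt (fun x => q * Complex.exp x) 0 := by fun_prop
  have h' : IsAdmissible (a * Complex.exp (Complex.I * 0)) (c * Complex.exp (2 * Complex.I * 0))
      (q * Complex.exp 0) l m n := by simpa using h
  have key := tendsto_nhds_unique_of_frequently_eq (continuousAt_phiSum hA hC hQ h')
    (continuousAt_expansionSum hA hC hQ h')
    ((frequently_isGeneric h.a_ne h.c_ne h.q_ne).mono
      fun x hx => phiSum_eq_expansionSum_of_isGeneric hx l m n)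
  simpa using key

/-! ### The identity in terms of basic hypergeometric series -/

theorem basicHyp_eq_phiSum {q : ℂ} (hq0 : q ≠ 0) (a c : ℂ) (l m n : ℕ) :
    basicHyp
        [a, q ^ (1 + l) / a, q ^ (-(n : ℤ)), -q ^ (-(m : ℤ) - n)]
        [c, q ^ (1 + (l : ℤ) - m - 2 * n) / c, -q] q q = phiSum a c q l m n := by
  have e1 : q ^ (-(n : ℤ)) = (q ^ n)⁻¹ := by rw [zpow_neg, zpow_natCast]
  have e2 : q ^ (-(m : ℤ) - n) = (q ^ (m + n))⁻¹ := by
    rw [← zpow_natCast, ← zpow_neg]; congr 1; push_cast; ring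
  have e3 : q ^ (1 + (l : ℤ) - m - 2 * n) / c = q ^ (1 + l) / (q ^ (m + 2 * n) * c) := by
    rw [← zpow_natCast, ← zpow_natCast, ← div_div, ← zpow_sub₀ hq0]
    congr 2; push_cast; ring
  rw [e1, e2, e3, basicHyp, tsum_eq_sum (s := range (n + 1)), phiSum]
  · refine sum_congr rfl fun k _ => ?_
    simp only [basicHypTerm, qFrac, List.map_cons, List.map_nil, List.prod_cons, List.prod_nil]
    ring
  · intro k hk
    have := qShifted_inv_pow_eq_zero hq0 (n := n) (k := k) (by simpa using hk)
    simp [basicHypTerm, qFrac, this]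

theorem theorem14 (a c q : ℂ) (ℓ m n : ℕ)
    (hq0 : q ≠ 0) (ha0 : a ≠ 0) (hc0 : c ≠ 0)
    (hq : ∀ k : ℕ, 1 ≤ k → k ≤ max ℓ (2 * m + 2 * n) → q ^ k ≠ 1)
    (ha : ∀ k : ℕ, 1 ≤ k → k ≤ 2 * ℓ + 1 → a ^ 2 ≠ q ^ k)
    (hac : ∀ k : ℕ, 2 ≤ k → k ≤ ℓ + 1 → a * c ≠ q ^ k)
    (hc1 : ∀ k : ℕ, 1 ≤ k → k ≤ ℓ → c ≠ -q ^ k)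
    (hc2 : ∀ k : ℕ, k < m + n → c ^ 2 * q ^ (2 * k) ≠ 1)
    (hc3 : ∀ k : ℕ, k < n → c * q ^ (m + n + k) ≠ q ^ ℓ) :
    basicHyp
        [a, q ^ (1 + ℓ) / a, q ^ (-(n : ℤ)), -q ^ (-(m : ℤ) - n)]
        [c, q ^ (1 + (ℓ : ℤ) - m - 2 * n) / c, -q] q q =
      qFrac q [q ^ 2 / (a * c), -q / a] [q ^ 2 / a ^ 2, -q / c] ℓ *
      qFrac q [q ^ (1 + m + n), -q ^ (-(ℓ : ℤ)) * c] [q ^ ((n : ℤ) + m - ℓ) * c, -q] n *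
      ∑ i ∈ Finset.range (ℓ + 1), ∑ j ∈ Finset.range (m + 1),
        q ^ (((ℓ : ℤ) + 1) * i - n * j + ((j + 1).choose 2 : ℕ)) *
        ((-1) ^ (i + j) / c ^ i) *
        ((1 - q ^ (1 + 2 * i) / a ^ 2) / (1 - q / a ^ 2)) *
        qFrac q
          [q ^ (-(ℓ : ℤ)), c / a, q / a ^ 2]
          [q, q ^ 2 / (a * c), q ^ (2 + ℓ) / a ^ 2] i *
        qFrac q
          [q ^ (-(m : ℤ)), q ^ (-(m : ℤ) - n), -q ^ (-(m : ℤ) - n),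
            q ^ (-(i : ℤ) - 1) * a * c, q ^ i * c / a]
          [q, c, -c, q ^ (-(m : ℤ) - 2 * n), q ^ ((j : ℤ) - 2 * m - 2 * n - 1)] j *
        qFrac (q ^ 2)
          [q ^ ((j : ℤ) - i) * a * c, q ^ (1 + i + j) * c / a]
          [q, q ^ (2 * j) * c ^ 2] (m + n - j) := by
  have h : IsAdmissible a c q ℓ m n := ⟨hq0, ha0, hc0, hq, ha, hac, hc1, hc2, hc3⟩
  rw [basicHyp_eq_phiSum hq0, phiSum_eq_expansionSum h, expansionSum]
  have hneg : ∀ k : ℕ, q ^ (-(k : ℤ)) = (q ^ k)⁻¹ := fun k => by rw [zpow_neg, zpow_natCast]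
  -- The negative exponents of the statement, written as quotients of natural powers.
  have hdiv : ∀ (s t : ℕ) (z : ℤ), z = s - t → q ^ z = q ^ s / q ^ t := fun s t z hz => by
    rw [hz, zpow_sub₀ hq0, zpow_natCast, zpow_natCast]
  have hinv : ∀ (t : ℕ) (z : ℤ), z = -t → q ^ z = (q ^ t)⁻¹ := fun t z hz => by rw [hz, hneg]
  congr 1
  · congr 1
    · simp only [qFrac, List.map_cons, List.map_nil, List.prod_cons, List.prod_nil, mul_one,
        neg_sq, neg_mul_neg, div_neg, neg_div]
      ring
    · rw [hneg, hdiv (m + n) ℓ _ (by push_cast; ring)]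
      simp only [qFrac, List.map_cons, List.map_nil, List.prod_cons, List.prod_nil, mul_one]
      have e1 : -(q ^ ℓ)⁻¹ * c = -c / q ^ ℓ := by ring
      have e2 : q ^ (m + n) / q ^ ℓ * c = q ^ (m + n) * c / q ^ ℓ := by ring
      rw [e1, e2]
  · refine sum_congr rfl fun i _ => ?_
    rw [mul_sum]
    refine sum_congr rfl fun j _ => ?_
    have z1 : q ^ (((ℓ : ℤ) + 1) * i - n * j + ((j + 1).choose 2 : ℕ)) =
        (q ^ (ℓ + 1)) ^ i * q ^ ((j + 1).choose 2) / q ^ (n * j) := by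
      rw [hdiv ((ℓ + 1) * i + (j + 1).choose 2) (n * j) _ (by push_cast; ring), pow_add, pow_mul]
    rw [z1, hneg, hneg, hinv (m + n) _ (by push_cast; ring), hinv (i + 1) _ (by push_cast; ring),
      hinv (m + 2 * n) _ (by push_cast; ring),
      hdiv j (2 * (m + n) + 1) _ (by push_cast; ring), hdiv j i _ rfl]
    have hi := pow_ne_zero i hq0
    have e1 : q * (q ^ i * c / a) * (a * c / q ^ (i + 1)) = c ^ 2 := by
      simpa using h.mul_params i 0
    have e2 := h.mul_params i j
    have e3 : q * (q ^ i * c / a * q ^ j) = q ^ (1 + i + j) * c / a := by ring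
    have e4 : q * (a * c / q ^ (i + 1) * q ^ j) = q ^ j / q ^ i * a * c := by
      rw [pow_succ]; field_simp
    have e5 : c ^ 2 * (q ^ 2) ^ j = q ^ (2 * j) * c ^ 2 := by ring
    have e6 : (q ^ (i + 1))⁻¹ * a * c = a * c / q ^ (i + 1) := by ring
    have e7 : q / a ^ 2 * q ^ (2 * i) = q ^ (1 + 2 * i) / a ^ 2 := by ring
    have e8 : q / a ^ 2 * q ^ (ℓ + 1) = q ^ (2 + ℓ) / a ^ 2 := by ring
    have e9 : (q ^ (ℓ + 1) / -c) ^ i = (q ^ (ℓ + 1)) ^ i * ((-1) ^ i / c ^ i) := by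
      rw [div_neg, neg_pow, div_pow]; ring
    simp only [shiftCoeff, watsonCoeff, qFrac, List.map_cons, List.map_nil, List.prod_cons,
      List.prod_nil, mul_one, neg_sq, neg_mul_neg, neg_div_neg_eq]
    rw [e2, e1, e3, e4, e5, e6, e7, e8, e9, ← qShifted_mul_qShifted_neg c, pow_add (-1 : ℂ)]
    ring
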